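/- Let $\xi$ be a random variable with values in $\{0,1,2,\dots\}$ such that $\mathbb{E}\,\xi=1$ and $0<\sigma^2:=\operatorname{Var}\xi<\infty$, and let $p_k:=\mathbb{P}(\xi=k)$. Let $\mathcal{T}$ be the Galton–Watson tree with offspring distribution $\xi$ (the random ordered rooted tree in which the numbers of children of the nodes are independent copies of $\xi$), and, for $n$ with $\mathbb{P}(|\mathcal{T}|=n)>0$, let $\mathcal{T}_n$ be $\mathcal{T}$ conditioned on having exactly $n$ nodes. For a finite rooted tree $T$ and an integer $r\ge 0$, let $n_r(T)$ be the number of nodes of $T$ of outdegree $r$, i.e. with exactly $r$ children. Then, for all integers $r,s\ge 0$, as $n\to\infty$ through the integers with $\mathbb{P}(|\mathcal{T}|=n)>0$, $$\frac{\operatorname{Cov}\bigl(n_r(\mathcal{T}_n),n_s(\mathcal{T}_n)\bigr)}{n}\;\longrightarrow\;\delta_{rs}\,p_r-p_rp_s-\frac{(r-1)(s-1)}{\sigma^2}\,p_rp_s,$$ where $\delta_{rs}=1$ if $r=s$ and $\delta_{rs}=0$ otherwise. In particular, for every $r\ge 0$, $$\frac{\operatorname{Var}\bigl(n_r(\mathcal{T}_n)\bigr)}{n}\;\longrightarrow\;p_r(1-p_r)-\frac{(r-1)^2p_r^2}{\sigma^2}.$$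 -/

import Mathlib

open MeasureTheory ProbabilityTheory Filter Topology

namespace GaltonWatson

/-- The ordered rooted tree, as a set of nodes in Ulam–Harris notation, in which node `u` is
assigned `c u` children. The root is the empty word and the children of the node `u` are
`u ++ [0], …, u ++ [c u - 1]`, in this order. Hence a word is a node if and only if each of its
nonempty prefixes `v ++ [i]` satisfies `i < c v`. -/
def tree (c : List ℕ → ℕ) : Set (List ℕ) :=
  {u | ∀ (v : List ℕ) (i : ℕ), v ++ [i] <+: u → i < c v}

/-- The outdegree (number of children) of the node `u` in the tree `T`. -/
noncomputable def outdegree (T : Set (List ℕ)) (u : List ℕ) : ℕ :=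
  {i : ℕ | u ++ [i] ∈ T}.ncard

/-- The number `n_r(T)` of nodes of outdegree `r` in the (finite) tree `T`. -/
noncomputable def numOutdegree (r : ℕ) (T : Set (List ℕ)) : ℕ :=
  {u ∈ T | outdegree T u = r}.ncard

variable {Ω : Type*}

/-- The random tree in which each potential node `u` has the random number `ξ u` of children.
If the `ξ u` are independent copies of `ξ`, this is the Galton–Watson tree. -/
def gwTree (ξ : List ℕ → Ω → ℕ) (ω : Ω) : Set (List ℕ) :=
  tree (fun u => ξ u ω)

/-- The event `|𝒯| = n` that the Galton–Watson tree has exactly `n` nodes. -/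
def sizeEvent (ξ : List ℕ → Ω → ℕ) (n : ℕ) : Set Ω :=
  {ω | (gwTree ξ ω).encard = n}

/-- The probability measure `P(· | |𝒯| = n)`. Under it, the random tree `gwTree ξ` is
the conditioned Galton–Watson tree `𝒯ₙ`. -/
noncomputable def condMeasure [MeasurableSpace Ω] (P : Measure Ω) (ξ : List ℕ → Ω → ℕ)
    (n : ℕ) : Measure Ω :=
  P[|sizeEvent ξ n]

end GaltonWatson

/-! Reading outdegrees in depth-first order turns a tree with n nodes into a word w, and the tree
has probability ∏ p_{w_i}. Conditional moments of n_r and n_s are therefore ratios of weighted sums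
over words. By the hitting time theorem (`natCast_mul_sum_forestWords`), such a sum with weights q_k
in a commutative ℚ-algebra equals (1/n)[z^{n-1}] F^n, where F = ∑ q_k z^k. Taking q_k = p_k (1 +
1_{k=r} x)(1 + 1_{k=s} y) with x² = y² = 0 and comparing coefficients gives the first and mixed
moments exactly (`sum_forestWords_moments`).

Let f = ∑ p_k z^k, D = [z^{n-1}] f^n, C_r = [z^{n-1}] z^r f^{n-1} and C_{rs} = [z^{n-1}] z^{r+s}
f^{n-2}. Then Cov/n = δ_{rs} p_r C_r/D - p_r p_s C_{rs}/D + p_r p_s n (D C_{rs} - C_r C_s)/D².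

If p_r p_s ≠ 0, Fourier inversion writes these coefficients, up to a common factor, as integrals of
ψ^{m+j} e^{ibt}, with m = n - 2 and ψ the characteristic function of ξ - 1 (`coeff_eq_oscInt`). By
Laplace's method all are asymptotic to the same c/√m, so the ratios tend to 1. In the determinant D
C_{rs} - C_r C_s the two products have the same total j and the same total b, so the leading terms
cancel and the surviving quadratic terms give -(r-1)(s-1)/σ² (`HasQuadraticMax.tendsto_det_oscInt`).
Two moments of ξ suffice. -/

namespace GaltonWatson

/-! ### Depth-first words of ordered forests. -/

/-- The words of outdegrees, in depth-first order, of the ordered forests with `n` nodes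
and `k` trees. -/
def forestWords : ℕ → ℕ → Finset (List ℕ)
  | 0, 0 => {[]}
  | 0, _ + 1 => ∅
  | _ + 1, 0 => ∅
  | n + 1, k + 1 =>
    (Finset.range (n + 1)).biUnion fun j => (forestWords n (k + j)).image (List.cons j)

lemma forestWords_eq_empty {n k : ℕ} (h : n < k) : forestWords n k = ∅ := by
  induction n generalizing k with
  | zero =>
    obtain ⟨k, rfl⟩ : ∃ l, k = l + 1 := ⟨k - 1, by omega⟩
    rfl
  | succ n ih =>
    obtain ⟨k, rfl⟩ : ∃ l, k = l + 1 := ⟨k - 1, by omega⟩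
    rw [forestWords, ← Finset.not_nonempty_iff_eq_empty]
    rintro ⟨w, hw⟩
    simp only [Finset.mem_biUnion, Finset.mem_image] at hw
    obtain ⟨j, -, v, hv, -⟩ := hw
    rw [ih (by omega)] at hv
    simp at hv

lemma nil_mem_forestWords {n k : ℕ} : [] ∈ forestWords n k ↔ n = 0 ∧ k = 0 := by
  cases n <;> cases k <;> simp [forestWords]

lemma cons_mem_forestWords {n k j : ℕ} {w : List ℕ} :
    j :: w ∈ forestWords (n + 1) (k + 1) ↔ w ∈ forestWords n (k + j) := by
  simp only [forestWords, Finset.mem_biUnion, Finset.mem_range, Finset.mem_image, List.cons.injEq]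
  constructor
  · rintro ⟨a, -, b, hb, rfl, rfl⟩
    exact hb
  · intro h
    refine ⟨j, ?_, w, h, rfl, rfl⟩
    by_contra hj
    rw [forestWords_eq_empty (by omega)] at h
    simp at h

/-! ### The hitting time theorem over a commutative ring. -/

section Algebra

variable {R : Type*} [CommRing R]

lemma sum_forestWords_succ (q : ℕ → R) (n k : ℕ) :
    ∑ w ∈ forestWords (n + 1) (k + 1), (w.map q).prod =
      ∑ j ∈ Finset.range (n + 1), q j * ∑ w ∈ forestWords n (k + j), (w.map q).prod := by
  rw [forestWords, Finset.sum_biUnion]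
  · refine Finset.sum_congr rfl fun j _ => ?_
    rw [Finset.sum_image (by simp), Finset.mul_sum]
    simp
  · intro i _ j _ hij
    simp only [Function.onFun, Finset.disjoint_left, Finset.mem_image, not_exists, not_and]
    rintro _ ⟨v, _, rfl⟩ w _ h
    exact hij (by simp_all)

open PowerSeries in
lemma coeff_X_mul_derivative (f : PowerSeries R) (n : ℕ) :
    coeff n (X * derivative R f) = n * coeff n f := by
  cases n with
  | zero => simp
  | succ n =>
    rw [coeff_succ_X_mul, coeff_derivative]
    push_cast
    ring

open PowerSeries in
/-- The weighted number of forests, by the hitting time theorem. -/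
lemma natCast_mul_sum_forestWords [Algebra ℚ R] (q : ℕ → R) (n k : ℕ) (hk : k ≤ n) :
    (n : R) * ∑ w ∈ forestWords n k, (w.map q).prod =
      k * coeff (n - k) (PowerSeries.mk q ^ n) := by
  induction n generalizing k with
  | zero =>
    obtain rfl : k = 0 := by omega
    simp
  | succ m ih =>
    cases k with
    | zero => simp [forestWords]
    | succ k =>
      rw [sum_forestWords_succ]
      rcases Nat.eq_zero_or_pos m with rfl | hm
      · obtain rfl : k = 0 := by omega
        simp [forestWords]
      -- The induction hypothesis only controls m times each inner sum, so m must be cancelled; this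
      -- is where the ℚ-algebra structure enters.
      have hu : IsUnit (m : R) := by
        have : IsUnit (m : ℚ) := by simpa using hm.ne'
        simpa using this.map (algebraMap ℚ R)
      refine hu.mul_left_cancel ?_
      have hkm : k ≤ m := by omega
      set f := PowerSeries.mk q with hf
      have h1 : (m : R) * ∑ j ∈ Finset.range (m + 1), q j *
            ∑ w ∈ forestWords m (k + j), (w.map q).prod =
          ∑ j ∈ Finset.range (m - k + 1), q j * (((k + j : ℕ) : R) *
            coeff (m - k - j) (f ^ m)) := by
        rw [Finset.mul_sum]
        symm
        refine Finset.sum_subset_zero_on_sdiff (fun j hj => ?_) (fun j hj => ?_) (fun j hj => ?_)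
        · simp only [Finset.mem_range] at hj ⊢
          omega
        · simp only [Finset.mem_sdiff, Finset.mem_range] at hj
          rw [forestWords_eq_empty (by omega)]
          simp
        · simp only [Finset.mem_range] at hj
          rw [Nat.sub_sub, ← ih (k + j) (by omega)]
          ring
      have h2 : ∑ j ∈ Finset.range (m - k + 1), q j * coeff (m - k - j) (f ^ m) =
          coeff (m - k) (f ^ (m + 1)) := by
        rw [pow_succ', coeff_mul, Finset.Nat.sum_antidiagonal_eq_sum_range_succ_mk]
        simp [hf]
      -- The weight j becomes a derivative: (m+1) (X f') f^m = X (f^{m+1})', and X d/dX multiplies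
      -- the coefficient of degree m - k by m - k.
      have h3 : ((m + 1 : ℕ) : R) *
            ∑ j ∈ Finset.range (m - k + 1), q j * (j * coeff (m - k - j) (f ^ m)) =
          ((m - k : ℕ) : R) * coeff (m - k) (f ^ (m + 1)) := by
        rw [← coeff_X_mul_derivative, derivative_pow]
        have : X * (((m + 1 : ℕ) : PowerSeries R) * f ^ (m + 1 - 1) * derivative R f) =
            C ((m + 1 : ℕ) : R) * ((X * derivative R f) * f ^ m) := by
          simp only [Nat.add_sub_cancel, map_natCast]
          ring
        rw [this, coeff_C_mul, coeff_mul, Finset.Nat.sum_antidiagonal_eq_sum_range_succ_mk]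
        congr 1
        refine Finset.sum_congr rfl fun j _ => ?_
        simp only [coeff_X_mul_derivative, hf, coeff_mk]
        ring
      have h4 : ∑ j ∈ Finset.range (m - k + 1), q j * (((k + j : ℕ) : R) *
            coeff (m - k - j) (f ^ m)) = k * coeff (m - k) (f ^ (m + 1)) +
          ∑ j ∈ Finset.range (m - k + 1), q j * (j * coeff (m - k - j) (f ^ m)) := by
        rw [← h2, Finset.mul_sum, ← Finset.sum_add_distrib]
        refine Finset.sum_congr rfl fun j _ => ?_
        push_cast
        ring
      rw [Nat.add_sub_add_right]
      rw [h4] at h1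
      push_cast [Nat.cast_sub hkm] at h3 ⊢
      linear_combination (m + 1 : R) * h1 + h3

/-- The xy-term arises either from one factor c or from one factor a and one factor b in different
places. The exponent n + 2 avoids truncated subtraction. -/
lemma add_pow_of_sq_eq_zero {x y : R} (hx : x ^ 2 = 0) (hy : y ^ 2 = 0) (F a b c : R) (n : ℕ) :
    (F + (x * a + y * b + x * y * c)) ^ (n + 2) =
      F ^ (n + 2) + x * ((n + 2) * (a * F ^ (n + 1))) + y * ((n + 2) * (b * F ^ (n + 1))) +
        x * y * ((n + 2) * (c * F ^ (n + 1)) + (n + 2) * (n + 1) * (a * b * F ^ n)) := by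
  induction n with
  | zero =>
    push_cast
    linear_combination (a ^ 2 + 2 * y * a * c + y ^ 2 * c ^ 2) * hx + (b ^ 2 + 2 * x * b * c) * hy
  | succ n ih =>
    rw [show n + 1 + 2 = (n + 2) + 1 by ring, pow_succ, ih]
    push_cast
    linear_combination (
      (n + 2) * (a * F ^ (n + 1)) * (a + y * c) +
      y * ((n + 2) * (c * F ^ (n + 1)) + (n + 2) * (n + 1) * (a * b * F ^ n)) * (a + y * c)) * hx +
      ((n + 2) * (b * F ^ (n + 1)) * (b + x * c) +
      x * ((n + 2) * (c * F ^ (n + 1)) + (n + 2) * (n + 1) * (a * b * F ^ n)) * b) * hy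

end Algebra

/-! ### Exact moments by nilpotent perturbation of the weights. -/

section Moments

open PowerSeries

variable {R : Type*} [CommRing R] [Algebra ℝ R]

/-- Since x² = 0, (1 + x)^k = 1 + kx, so the perturbed weight of a word records its letter counts
linearly. -/
lemma list_prod_one_add {x y : R} (hx : x ^ 2 = 0) (hy : y ^ 2 = 0)
    (p : ℕ → ℝ) (r s : ℕ) (w : List ℕ) :
    (w.map fun j => (algebraMap ℝ R (p j) *
      ((1 + (if j = r then 1 else 0) * x) *
        (1 + (if j = s then 1 else 0) * y)))).prod =
      algebraMap ℝ R (w.map p).prod *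
        ((1 + (w.count r : R) * x) *
        (1 + (w.count s : R) * y)) := by
  have key (z : R) (hz : z ^ 2 = 0) (r j : ℕ) (w : List ℕ) :
      (1 + (if j = r then 1 else 0) * z) * (1 + (w.count r : R) * z) =
        1 + ((j :: w).count r : R) * z := by
    rw [List.count_cons]
    by_cases h : j = r
    · simp only [h, if_true, BEq.rfl]
      push_cast
      linear_combination (w.count r : R) * hz
    · simp [h]
  induction w with
  | nil => simp
  | cons j w ih =>
    rw [List.map_cons, List.prod_cons, ih, List.map_cons, List.prod_cons, map_mul,
      ← key x hx r j w, ← key y hy s j w]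
    ring

/-- The hitting time theorem with k = 1 for the perturbed series f + x p_r X^r + y p_s X^s + xy
δ_{rs} p_r X^r. -/
lemma natCast_mul_sum_one_add [Algebra ℚ R] {x y : R} (hx : x ^ 2 = 0) (hy : y ^ 2 = 0)
    (p : ℕ → ℝ) (r s n : ℕ) :
    ((n + 2 : ℕ) : R) * ∑ w ∈ forestWords (n + 2) 1,
      (algebraMap ℝ R (w.map p).prod *
        ((1 + (w.count r : R) * x) *
        (1 + (w.count s : R) * y))) =
    algebraMap ℝ R (coeff (n + 1) (mk p ^ (n + 2))) +
      x * algebraMap ℝ R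
        ((n + 2) * (p r * coeff (n + 1) (X ^ r * mk p ^ (n + 1)))) +
      y * algebraMap ℝ R
        ((n + 2) * (p s * coeff (n + 1) (X ^ s * mk p ^ (n + 1)))) +
      x * y *
        algebraMap ℝ R
        ((n + 2) * ((if r = s then p r else 0) * coeff (n + 1) (X ^ r * mk p ^ (n + 1))) +
         (n + 2) * (n + 1) * (p r * p s * coeff (n + 1) (X ^ (r + s) * mk p ^ n))) := by
  simp_rw [← list_prod_one_add hx hy]
  rw [natCast_mul_sum_forestWords _ _ _ (by omega)]
  set φ := PowerSeries.map (algebraMap ℝ R) with hφ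
  have hf : (mk fun j => (algebraMap ℝ R (p j) *
      ((1 + (if j = r then 1 else 0) * x) * (1 + (if j = s then 1 else 0) * y)))) =
      φ (mk p) + (C x * φ (C (p r) * X ^ r) + C y * φ (C (p s) * X ^ s) +
        C x * C y * φ (C (if r = s then p r else 0) * X ^ r)) := by
    ext1 j
    simp only [map_add, coeff_mk, mul_assoc, coeff_C_mul, hφ, coeff_map, coeff_X_pow]
    by_cases h1 : j = r <;> by_cases h2 : j = s
    · subst h1 h2
      simp
      ring
    · subst h1
      simp [h2]
      ring
    · subst h2
      have : ¬ r = j := fun h => h1 h.symm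
      simp [h1]
      ring
    · simp [h1, h2]
  rw [hf, add_pow_of_sq_eq_zero (by rw [← map_pow, hx, map_zero]) (by rw [← map_pow, hy, map_zero])]
  have e1 (t : ℕ) (a : ℝ) (m k : ℕ) : φ (C a * X ^ t) * φ (mk p) ^ m =
      φ (C a * (X ^ t * mk p ^ m)) := by
    simp only [map_mul, map_pow, mul_assoc]
  have e2 : φ (C (p r) * X ^ r) * φ (C (p s) * X ^ s) * φ (mk p) ^ n =
      φ (C (p r * p s) * (X ^ (r + s) * mk p ^ n)) := by
    simp only [map_mul, map_pow, pow_add]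
    ring
  have e3 : (n + 2 : PowerSeries R) = φ (C (n + 2 : ℝ)) := by
    simp only [map_add, map_natCast, map_ofNat]
  have e4 : (n + 1 : PowerSeries R) = φ (C (n + 1 : ℝ)) := by simp
  have e5 (m : ℕ) (a b : ℝ) (g : PowerSeries ℝ) : coeff m (φ (C a) * φ (C b * g)) =
      algebraMap ℝ R (a * (b * coeff m g)) := by
    rw [← map_mul, hφ, coeff_map, coeff_C_mul, coeff_C_mul]
  have e6 (m : ℕ) (a b c : ℝ) (g : PowerSeries ℝ) :
      coeff m (φ (C a) * φ (C b) * φ (C c * g)) = algebraMap ℝ R (a * b * (c * coeff m g)) := by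
    rw [← map_mul, ← map_mul C, e5]
  rw [e1 _ _ _ 0, e1 _ _ _ 0, e1 _ _ _ 0, e2, e3, e4, ← map_pow]
  generalize (n + 2 : ℝ) = c₂, (n + 1 : ℝ) = c₁
  rw [map_add, map_add, map_add, coeff_C_mul, coeff_C_mul, ← map_mul C, coeff_C_mul, map_add]
  rw [e5, e5, e5, e6, hφ, coeff_map, ← map_add, Nat.cast_one, one_mul]
  rfl

/-- Comparison of coefficients in the algebra of dual numbers over the dual numbers. -/
lemma dualNumber_ext {a b c d a' b' c' d' : ℝ}
    (h : algebraMap ℝ (DualNumber (DualNumber ℝ)) a +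
        TrivSqZeroExt.inl DualNumber.eps * algebraMap ℝ (DualNumber (DualNumber ℝ)) b +
        DualNumber.eps * algebraMap ℝ (DualNumber (DualNumber ℝ)) c +
        TrivSqZeroExt.inl DualNumber.eps * DualNumber.eps *
          algebraMap ℝ (DualNumber (DualNumber ℝ)) d =
      algebraMap ℝ (DualNumber (DualNumber ℝ)) a' +
        TrivSqZeroExt.inl DualNumber.eps * algebraMap ℝ (DualNumber (DualNumber ℝ)) b' +
        DualNumber.eps * algebraMap ℝ (DualNumber (DualNumber ℝ)) c' +
        TrivSqZeroExt.inl DualNumber.eps * DualNumber.eps *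
          algebraMap ℝ (DualNumber (DualNumber ℝ)) d') :
    a = a' ∧ b = b' ∧ d = d' := by
  refine ⟨?_, ?_, ?_⟩
  · simpa [TrivSqZeroExt.algebraMap_eq_inl'] using congrArg (fun z => z.fst.fst) h
  · simpa [TrivSqZeroExt.algebraMap_eq_inl'] using congrArg (fun z => z.fst.snd) h
  · simpa [TrivSqZeroExt.algebraMap_eq_inl'] using congrArg (fun z => z.snd.snd) h

/-- Two layers of dual numbers supply x and y with 1, x, y, xy independent over ℝ, so the
coefficients of 1, x and xy can be read off. -/
lemma sum_forestWords_moments (p : ℕ → ℝ) (r s n : ℕ) :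
    (n + 2) * ∑ w ∈ forestWords (n + 2) 1, (w.map p).prod = coeff (n + 1) (mk p ^ (n + 2)) ∧
    ∑ w ∈ forestWords (n + 2) 1, (w.map p).prod * w.count r =
      p r * coeff (n + 1) (X ^ r * mk p ^ (n + 1)) ∧
    ∑ w ∈ forestWords (n + 2) 1, (w.map p).prod * (w.count r * w.count s) =
      (if r = s then p r else 0) * coeff (n + 1) (X ^ r * mk p ^ (n + 1)) +
        (n + 1) * (p r * p s * coeff (n + 1) (X ^ (r + s) * mk p ^ n)) := by
  have hx : (TrivSqZeroExt.inl DualNumber.eps : DualNumber (DualNumber ℝ)) ^ 2 = 0 := by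
    rw [sq, ← TrivSqZeroExt.inl_mul, DualNumber.eps_mul_eps, TrivSqZeroExt.inl_zero]
  have hy : (DualNumber.eps : DualNumber (DualNumber ℝ)) ^ 2 = 0 := by
    rw [sq, DualNumber.eps_mul_eps]
  have h := natCast_mul_sum_one_add (R := DualNumber (DualNumber ℝ)) hx hy p r s n
  have e : ((n + 2 : ℕ) : DualNumber (DualNumber ℝ)) =
      algebraMap ℝ (DualNumber (DualNumber ℝ)) (n + 2) := by
    rw [map_add, map_natCast, map_ofNat]
    push_cast
    rfl
  have hsum : ((n + 2 : ℕ) : DualNumber (DualNumber ℝ)) * ∑ w ∈ forestWords (n + 2) 1,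
      (algebraMap ℝ (DualNumber (DualNumber ℝ)) (w.map p).prod *
        ((1 + (w.count r : DualNumber (DualNumber ℝ)) * TrivSqZeroExt.inl DualNumber.eps) *
        (1 + (w.count s : DualNumber (DualNumber ℝ)) * DualNumber.eps))) =
      algebraMap ℝ (DualNumber (DualNumber ℝ))
        ((n + 2) * ∑ w ∈ forestWords (n + 2) 1, (w.map p).prod) +
      TrivSqZeroExt.inl DualNumber.eps * algebraMap ℝ (DualNumber (DualNumber ℝ))
        ((n + 2) * ∑ w ∈ forestWords (n + 2) 1, (w.map p).prod * w.count r) +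
      DualNumber.eps * algebraMap ℝ (DualNumber (DualNumber ℝ))
        ((n + 2) * ∑ w ∈ forestWords (n + 2) 1, (w.map p).prod * w.count s) +
      TrivSqZeroExt.inl DualNumber.eps * DualNumber.eps *
        algebraMap ℝ (DualNumber (DualNumber ℝ))
        ((n + 2) * ∑ w ∈ forestWords (n + 2) 1, (w.map p).prod * (w.count r * w.count s)) := by
    rw [e]
    simp only [map_mul, map_sum, Finset.mul_sum, ← Finset.sum_add_distrib, map_natCast]
    refine Finset.sum_congr rfl fun w _ => ?_
    ring
  rw [hsum] at h
  obtain ⟨h1, h2, h3⟩ := dualNumber_ext h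
  have hn : (n + 2 : ℝ) ≠ 0 := by positivity
  refine ⟨h1, mul_left_cancel₀ hn h2, mul_left_cancel₀ hn ?_⟩
  rw [h3]
  ring

end Moments

/-! ### Depth-first exploration of a deterministic tree. -/

section Exploration

variable {c : List ℕ → ℕ} {u : List ℕ} {s : List (List ℕ)} {w : List ℕ}

/-- The subtree of descendants of `u`, including `u`. -/
def subtree (c : List ℕ → ℕ) (u : List ℕ) : Set (List ℕ) :=
  {v | u <+: v ∧ ∀ (x : List ℕ) (i : ℕ), u <+: x → x ++ [i] <+: v → i < c x}

/-- The union of the subtrees rooted at the nodes in `s`. -/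
def forest (c : List ℕ → ℕ) (s : List (List ℕ)) : Set (List ℕ) :=
  {v | ∃ u ∈ s, v ∈ subtree c u}

/-- The first `j` potential children of `u`. -/
def children (u : List ℕ) (j : ℕ) : List (List ℕ) :=
  (List.range j).map fun i => u ++ [i]

/-- The depth-first exploration of the forest rooted at `s` reads the outdegrees `w`. -/
def Explores (c : List ℕ → ℕ) : List (List ℕ) → List ℕ → Prop
  | [], [] => True
  | u :: s, j :: w => c u = j ∧ Explores c (children u j ++ s) w
  | [], _ :: _ => False
  | _ :: _, [] => False

/-- No two distinct entries are comparable in the prefix order, and there are no repetitions. -/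
def Incomparable (s : List (List ℕ)) : Prop :=
  s.Pairwise fun u v => ¬ u <+: v ∧ ¬ v <+: u

lemma mem_children {j : ℕ} {v : List ℕ} : v ∈ children u j ↔ ∃ i < j, v = u ++ [i] := by
  simp [children, eq_comm]

lemma length_children (u : List ℕ) (j : ℕ) : (children u j).length = j := by
  simp [children]

lemma not_concat_prefix (u : List ℕ) (i : ℕ) : ¬ u ++ [i] <+: u := fun h => by
  simpa using h.length_le

/-- The invariant of the exploration stack: incomparable pending nodes have disjoint subtrees, so no
node is read twice. -/
lemma Incomparable.children_append (h : Incomparable (u :: s)) (j : ℕ) :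
    Incomparable (children u j ++ s) := by
  rw [Incomparable, List.pairwise_cons] at h
  obtain ⟨h1, h2⟩ := h
  rw [Incomparable, List.pairwise_append]
  refine ⟨?_, h2, ?_⟩
  · rw [children, List.pairwise_map]
    refine List.pairwise_lt_range.imp ?_
    intro a b hab
    constructor <;> intro hp <;> have := hp.eq_of_length (by simp) <;> simp at this <;> omega
  · intro x hx v hv
    obtain ⟨i, -, rfl⟩ := mem_children.1 hx
    refine ⟨fun hp => (h1 v hv).1 ((List.prefix_append _ _).trans hp), fun hp => ?_⟩
    rcases List.prefix_concat_iff.1 hp with rfl | hp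
    · exact (h1 _ hv).1 (List.prefix_append _ _)
    · exact (h1 v hv).2 hp

lemma subtree_eq (c : List ℕ → ℕ) (u : List ℕ) :
    subtree c u = insert u {v | ∃ i < c u, v ∈ subtree c (u ++ [i])} := by
  ext v
  simp only [Set.mem_insert_iff, Set.mem_ofPred_eq]
  constructor
  · rintro ⟨⟨t, rfl⟩, h⟩
    cases t with
    | nil => simp
    | cons i t =>
      have hp : u ++ [i] <+: u ++ i :: t := ⟨t, by simp⟩
      exact Or.inr ⟨i, h u i (List.prefix_refl u) hp, hp, fun x k hx hk =>
        h x k ((List.prefix_append _ _).trans hx) hk⟩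
  · rintro (rfl | ⟨i, hi, hp, h⟩)
    · exact ⟨List.prefix_refl _, fun x i hx hp => absurd (hp.trans hx) (not_concat_prefix x i)⟩
    · refine ⟨(List.prefix_append _ _).trans hp, fun x k hx hk => ?_⟩
      rcases eq_or_ne x u with rfl | hne
      · have := (List.prefix_of_prefix_length_le hk hp (by simp)).eq_of_length (by simp)
        simp only [List.append_cancel_left_eq, List.cons.injEq, and_true] at this
        omega
      · refine h x k (List.prefix_of_prefix_length_le hp ((List.prefix_append _ _).trans hk) ?_) hk
        have h1 := hx.length_le
        have h2 : u.length ≠ x.length := fun e => hne (hx.eq_of_length e).symm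
        simp only [List.length_append, List.length_singleton]
        omega

lemma forest_nil (c : List ℕ → ℕ) : forest c [] = ∅ := by
  simp [forest]

lemma forest_cons (c : List ℕ → ℕ) (u : List ℕ) (s : List (List ℕ)) :
    forest c (u :: s) = insert u (forest c (children u (c u) ++ s)) := by
  ext v
  simp only [forest, Set.mem_ofPred_eq, List.mem_cons, exists_eq_or_imp, List.mem_append,
    mem_children, Set.mem_insert_iff]
  rw [subtree_eq]
  simp only [Set.mem_insert_iff, Set.mem_ofPred_eq]
  constructor
  · rintro ((rfl | ⟨i, hi, h⟩) | ⟨a, ha, h⟩)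
    · exact Or.inl rfl
    · exact Or.inr ⟨_, Or.inl ⟨i, hi, rfl⟩, h⟩
    · exact Or.inr ⟨a, Or.inr ha, h⟩
  · rintro (rfl | ⟨a, ⟨i, hi, rfl⟩ | ha, h⟩)
    · exact Or.inl (Or.inl rfl)
    · exact Or.inl (Or.inr ⟨i, hi, h⟩)
    · exact Or.inr ⟨a, ha, h⟩

lemma Incomparable.not_mem_forest (h : Incomparable (u :: s)) (c : List ℕ → ℕ) (j : ℕ) :
    u ∉ forest c (children u j ++ s) := by
  rintro ⟨x, hx, hp, -⟩
  rcases List.mem_append.1 hx with hx | hx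
  · obtain ⟨i, -, rfl⟩ := mem_children.1 hx
    exact not_concat_prefix _ _ hp
  · rw [Incomparable, List.pairwise_cons] at h
    exact (h.1 x hx).2 hp

/-- Reading the top node removes exactly one node from the forest and replaces it on the stack by
its children, matching the recursion of `forestWords`. -/
lemma encard_forest_eq_iff {n : ℕ} (hs : Incomparable s) :
    (forest c s).encard = n ↔ ∃ w ∈ forestWords n s.length, Explores c s w := by
  induction n generalizing s with
  | zero =>
    cases s with
    | nil => simp [forest_nil, forestWords, Explores]
    | cons u s => simp [forest_cons, forestWords, (Set.insert_nonempty _ _).ne_empty]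
  | succ n ih =>
    cases s with
    | nil =>
      simp only [forest_nil, Set.encard_empty, List.length_nil, forestWords]
      norm_cast
      simp
    | cons u s =>
      rw [forest_cons, Set.encard_insert_of_notMem (hs.not_mem_forest c _), Nat.cast_add,
        Nat.cast_one, (ENat.add_left_injective_of_ne_top (n := 1) (by simp)).eq_iff,
        ih (hs.children_append _)]
      rw [List.length_append, length_children, List.length_cons, add_comm (c u)]
      constructor
      · rintro ⟨w, hw, h⟩
        exact ⟨c u :: w, cons_mem_forestWords.2 hw, rfl, h⟩
      · rintro ⟨w, hw, h⟩
        cases w with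
        | nil => simp [Explores] at h
        | cons j w =>
          obtain ⟨rfl, h⟩ := h
          exact ⟨w, cons_mem_forestWords.1 hw, h⟩

lemma encard_forest_sep (hs : Incomparable s) (h : Explores c s w) (r : ℕ) :
    {v ∈ forest c s | c v = r}.encard = w.count r := by
  induction w generalizing s with
  | nil =>
    cases s with
    | nil => simp [forest_nil]
    | cons u s => simp [Explores] at h
  | cons j w ih =>
    cases s with
    | nil => simp [Explores] at h
    | cons u s =>
      obtain ⟨rfl, h⟩ := h
      have ih := ih (hs.children_append _) h
      rw [forest_cons, List.count_cons]
      by_cases hr : c u = r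
      · have : {v ∈ insert u (forest c (children u (c u) ++ s)) | c v = r} =
            insert u {v ∈ forest c (children u (c u) ++ s) | c v = r} := by
          ext v
          simp only [Set.mem_ofPred_eq, Set.mem_insert_iff]
          constructor
          · rintro ⟨h1 | h1, h2⟩
            · exact Or.inl h1
            · exact Or.inr ⟨h1, h2⟩
          · rintro (rfl | ⟨h1, h2⟩)
            · exact ⟨Or.inl rfl, hr⟩
            · exact ⟨Or.inr h1, h2⟩
        rw [this, Set.encard_insert_of_notMem (fun h => hs.not_mem_forest c _ h.1), ih]
        simp [hr]
      · have : {v ∈ insert u (forest c (children u (c u) ++ s)) | c v = r} =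
            {v ∈ forest c (children u (c u) ++ s) | c v = r} := by
          ext v
          simp only [Set.mem_ofPred_eq, Set.mem_insert_iff]
          constructor
          · rintro ⟨rfl | h1, h2⟩
            · exact absurd h2 hr
            · exact ⟨h1, h2⟩
          · rintro ⟨h1, h2⟩
            exact ⟨Or.inr h1, h2⟩
        rw [this, ih]
        simp [hr]

lemma Explores.unique {w' : List ℕ} (h : Explores c s w) (h' : Explores c s w') : w = w' := by
  induction w generalizing s w' with
  | nil =>
    cases s <;> cases w' <;> simp_all [Explores]
  | cons j w ih =>
    cases s with
    | nil => simp [Explores] at h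
    | cons u s =>
      cases w' with
      | nil => simp [Explores] at h'
      | cons j' w' =>
        obtain ⟨rfl, h⟩ := h
        obtain ⟨rfl, h'⟩ := h'
        rw [ih h h']

lemma incomparable_root : Incomparable [[]] := by simp [Incomparable]

lemma forest_root (c : List ℕ → ℕ) : forest c [[]] = tree c := by
  simp [forest, subtree, tree]

lemma outdegree_tree (hu : u ∈ tree c) : outdegree (tree c) u = c u := by
  have : {i | u ++ [i] ∈ tree c} = Set.Iio (c u) := by
    ext i
    simp only [Set.mem_ofPred_eq, Set.mem_Iio]
    refine ⟨fun h => h u i (List.prefix_refl _), fun hi v k hp => ?_⟩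
    rcases List.prefix_concat_iff.1 hp with h | h
    · obtain ⟨rfl, h⟩ := List.append_inj' h rfl
      simp_all
    · exact hu v k h
  rw [outdegree, this, Set.ncard_eq_toFinset_card', Set.toFinset_Iio, Nat.card_Iio]

lemma Explores.numOutdegree_tree (h : Explores c [[]] w) (r : ℕ) :
    numOutdegree r (tree c) = w.count r := by
  have : {u ∈ tree c | outdegree (tree c) u = r} = {v ∈ forest c [[]] | c v = r} := by
    ext u
    rw [forest_root]
    simp only [Set.mem_ofPred_eq]
    exact and_congr_right fun hu => by rw [outdegree_tree hu]
  rw [numOutdegree, this, Set.ncard, encard_forest_sep incomparable_root h]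
  simp

end Exploration

/-! ### The size event as a disjoint union of word events. -/

section Events

variable {Ω : Type*} {ξ : List ℕ → Ω → ℕ}

/-- The event that the depth-first exploration of the Galton–Watson tree reads `w`. -/
def wordEvent (ξ : List ℕ → Ω → ℕ) (w : List ℕ) : Set Ω :=
  {ω | Explores (fun u => ξ u ω) [[]] w}

lemma sizeEvent_eq (ξ : List ℕ → Ω → ℕ) (n : ℕ) :
    sizeEvent ξ n = ⋃ w ∈ forestWords n 1, wordEvent ξ w := by
  ext ω
  simp only [sizeEvent, gwTree, Set.mem_ofPred_eq, ← forest_root,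
    encard_forest_eq_iff incomparable_root, Set.mem_iUnion, wordEvent, exists_prop]
  rfl

lemma pairwise_disjoint_wordEvent (ξ : List ℕ → Ω → ℕ) :
    Pairwise (Function.onFun Disjoint (wordEvent ξ)) := by
  intro v w hvw
  rw [Function.onFun, Set.disjoint_left]
  exact fun ω h h' => hvw (Explores.unique h h')

lemma numOutdegree_gwTree {w : List ℕ} {ω : Ω} (h : ω ∈ wordEvent ξ w) (r : ℕ) :
    numOutdegree r (gwTree ξ ω) = w.count r := Explores.numOutdegree_tree h r

end Events

/-! ### Law of the depth-first word and conditional moments. -/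

section Law

variable {Ω : Type*} [MeasurableSpace Ω] {P : Measure Ω}
  {ν : Measure ℕ} {ξ : List ℕ → Ω → ℕ}

lemma measurableSet_explores (hmeas : ∀ u, Measurable (ξ u)) (s : List (List ℕ)) (w : List ℕ) :
    MeasurableSet {ω | Explores (fun u => ξ u ω) s w} := by
  induction w generalizing s with
  | nil => cases s <;> simp [Explores]
  | cons j w ih =>
    cases s with
    | nil => simp [Explores]
    | cons u s =>
      exact (hmeas u (measurableSet_singleton j)).inter (ih _)

lemma measurableSet_wordEvent (hmeas : ∀ u, Measurable (ξ u)) (w : List ℕ) :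
    MeasurableSet (wordEvent ξ w) := measurableSet_explores hmeas _ w

/-- The induction carries the set K of nodes already read, with their values g. No pending node is a
prefix of a read one, so each newly read node is fresh, and independence is applied only once, when
the stack is empty. -/
lemma measureReal_explores (hmeas : ∀ u, Measurable (ξ u)) (hlaw : ∀ u, P.map (ξ u) = ν)
    (hindep : iIndepFun ξ P) {s : List (List ℕ)} {w : List ℕ} {n : ℕ}
    (hs : Incomparable s) (hw : w ∈ forestWords n s.length) (K : Finset (List ℕ))
    (g : List ℕ → ℕ) (hK : ∀ v ∈ K, ∀ u ∈ s, ¬ u <+: v) :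
    P.real {ω | (∀ v ∈ K, ξ v ω = g v) ∧ Explores (fun u => ξ u ω) s w} =
      (∏ v ∈ K, ν.real {g v}) * (w.map fun j => ν.real {j}).prod := by
  induction w generalizing s n K g with
  | nil =>
    cases s with
    | cons u s => simp [nil_mem_forestWords] at hw
    | nil =>
      have h := hindep.measure_inter_preimage_eq_mul K (sets := fun v => {g v})
        (fun _ _ => measurableSet_singleton _)
      have h2 : {ω | (∀ v ∈ K, ξ v ω = g v) ∧ Explores (fun u => ξ u ω) [] []} =
          ⋂ i ∈ K, ξ i ⁻¹' {g i} := by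
        ext ω
        simp [Explores]
      rw [h2, measureReal_def, h, ENNReal.toReal_prod]
      simp only [List.map_nil, List.prod_nil, mul_one]
      refine Finset.prod_congr rfl fun v _ => ?_
      rw [← hlaw v, measureReal_def, Measure.map_apply (hmeas v) (measurableSet_singleton _)]
  | cons j w ih =>
    cases n with
    | zero => cases s <;> simp [forestWords] at hw
    | succ n =>
    cases s with
    | nil => simp [forestWords] at hw
    | cons u s =>
      have huK : u ∉ K := fun h => hK u h u (by simp) (List.prefix_refl _)
      have hev : {ω | (∀ v ∈ K, ξ v ω = g v) ∧ Explores (fun u => ξ u ω) (u :: s) (j :: w)} =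
          {ω | (∀ v ∈ insert u K, ξ v ω = Function.update g u j v) ∧
            Explores (fun u => ξ u ω) (children u j ++ s) w} := by
        ext ω
        simp only [Set.mem_ofPred_eq, Finset.forall_mem_insert, Function.update_self]
        have : (∀ v ∈ K, ξ v ω = g v) ↔ ∀ v ∈ K, ξ v ω = Function.update g u j v := by
          refine forall₂_congr fun v hv => ?_
          rw [Function.update_of_ne (by rintro rfl; exact huK hv)]
        rw [this, Explores]
        tauto
      rw [hev, ih (n := n) (hs.children_append j), Finset.prod_insert huK, Function.update_self,
        List.map_cons, List.prod_cons, mul_assoc, mul_left_comm]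
      · congr 1
        refine Finset.prod_congr rfl fun v hv => ?_
        rw [Function.update_of_ne (by rintro rfl; exact huK hv)]
      · rw [List.length_append, length_children, add_comm j]
        exact cons_mem_forestWords.1 hw
      · intro v hv x hx hp
        rw [Incomparable, List.pairwise_cons] at hs
        rcases Finset.mem_insert.1 hv with rfl | hv
        · rcases List.mem_append.1 hx with hx | hx
          · obtain ⟨i, -, rfl⟩ := mem_children.1 hx
            exact not_concat_prefix _ _ hp
          · exact (hs.1 x hx).2 hp
        · rcases List.mem_append.1 hx with hx | hx
          · obtain ⟨i, -, rfl⟩ := mem_children.1 hx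
            exact hK v hv u (by simp) ((List.prefix_append _ _).trans hp)
          · exact hK v hv x (by simp [hx]) hp

lemma measureReal_wordEvent (hmeas : ∀ u, Measurable (ξ u)) (hlaw : ∀ u, P.map (ξ u) = ν)
    (hindep : iIndepFun ξ P) {w : List ℕ} {n : ℕ} (hw : w ∈ forestWords n 1) :
    P.real (wordEvent ξ w) = (w.map fun j => ν.real {j}).prod := by
  have := measureReal_explores hmeas hlaw hindep incomparable_root hw ∅ (fun _ => 0) (by simp)
  simpa [wordEvent] using this

lemma measurableSet_sizeEvent (hmeas : ∀ u, Measurable (ξ u)) (n : ℕ) :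
    MeasurableSet (sizeEvent ξ n) := by
  rw [sizeEvent_eq]
  exact Finset.measurableSet_biUnion _ fun w _ => measurableSet_wordEvent hmeas w

lemma measureReal_sizeEvent [IsFiniteMeasure P] (hmeas : ∀ u, Measurable (ξ u))
    (hlaw : ∀ u, P.map (ξ u) = ν)
    (hindep : iIndepFun ξ P) (n : ℕ) :
    P.real (sizeEvent ξ n) =
      ∑ w ∈ forestWords n 1, (w.map fun j => ν.real {j}).prod := by
  rw [sizeEvent_eq, measureReal_biUnion_finset
    ((pairwise_disjoint_wordEvent ξ).set_pairwise _) fun w _ => measurableSet_wordEvent hmeas w]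
  exact Finset.sum_congr rfl fun w hw => measureReal_wordEvent hmeas hlaw hindep hw

lemma ae_condMeasure_eq_sum_indicator (hmeas : ∀ u, Measurable (ξ u)) {n : ℕ} {X : Ω → ℝ}
    {φ : List ℕ → ℝ} (hX : ∀ w ∈ forestWords n 1, ∀ ω ∈ wordEvent ξ w, X ω = φ w) :
    X =ᵐ[condMeasure P ξ n]
      fun ω => ∑ w ∈ forestWords n 1, (wordEvent ξ w).indicator (fun _ => φ w) ω := by
  filter_upwards [ae_cond_mem (measurableSet_sizeEvent hmeas n)] with ω hω
  rw [sizeEvent_eq] at hω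
  simp only [Set.mem_iUnion, exists_prop] at hω
  obtain ⟨w, hw, hω⟩ := hω
  rw [hX w hw ω hω, Finset.sum_eq_single_of_mem w hw, Set.indicator_of_mem hω]
  intro v _ hv
  exact Set.indicator_of_notMem
    (fun h => Set.disjoint_left.1 (pairwise_disjoint_wordEvent ξ hv) h hω) _

instance (n : ℕ) : IsFiniteMeasure (condMeasure P ξ n) :=
  inferInstanceAs (IsFiniteMeasure (P[|sizeEvent ξ n]))

lemma memLp_condMeasure (hmeas : ∀ u, Measurable (ξ u)) {n : ℕ} {X : Ω → ℝ}
    {φ : List ℕ → ℝ} (hX : ∀ w ∈ forestWords n 1, ∀ ω ∈ wordEvent ξ w, X ω = φ w) :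
    MemLp X 2 (condMeasure P ξ n) := by
  rw [memLp_congr_ae (ae_condMeasure_eq_sum_indicator hmeas hX)]
  exact memLp_finsetSum _ fun w _ => (memLp_const _).indicator (measurableSet_wordEvent hmeas w)

lemma integral_condMeasure [IsFiniteMeasure P] (hmeas : ∀ u, Measurable (ξ u))
    (hlaw : ∀ u, P.map (ξ u) = ν)
    (hindep : iIndepFun ξ P) {n : ℕ} {X : Ω → ℝ}
    {φ : List ℕ → ℝ} (hX : ∀ w ∈ forestWords n 1, ∀ ω ∈ wordEvent ξ w, X ω = φ w) :
    ∫ ω, X ω ∂(condMeasure P ξ n) =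
      (∑ w ∈ forestWords n 1, (w.map fun j => ν.real {j}).prod)⁻¹ *
        ∑ w ∈ forestWords n 1, (w.map fun j => ν.real {j}).prod * φ w := by
  rw [integral_congr_ae (ae_condMeasure_eq_sum_indicator hmeas hX), integral_finsetSum]
  · rw [Finset.mul_sum]
    refine Finset.sum_congr rfl fun w hw => ?_
    rw [integral_indicator_const _ (measurableSet_wordEvent hmeas w), condMeasure,
      measureReal_def, cond_apply (measurableSet_sizeEvent hmeas n), Set.inter_eq_right.2,
      ENNReal.toReal_mul, ENNReal.toReal_inv, ← measureReal_def, ← measureReal_def,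
      measureReal_sizeEvent hmeas hlaw hindep, measureReal_wordEvent hmeas hlaw hindep hw,
      smul_eq_mul, mul_assoc]
    rw [sizeEvent_eq]
    exact Set.subset_biUnion_of_mem (u := fun w => wordEvent ξ w) hw
  · exact fun w _ => (integrable_const _).indicator (measurableSet_wordEvent hmeas w)

lemma covariance_numOutdegree [IsFiniteMeasure P] (hmeas : ∀ u, Measurable (ξ u))
    (hlaw : ∀ u, P.map (ξ u) = ν)
    (hindep : iIndepFun ξ P) {n : ℕ} (hn : P (sizeEvent ξ n) ≠ 0) (r s : ℕ) :
    cov[fun ω => (numOutdegree r (gwTree ξ ω) : ℝ), fun ω => (numOutdegree s (gwTree ξ ω) : ℝ);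
        condMeasure P ξ n] =
      (∑ w ∈ forestWords n 1, (w.map fun j => ν.real {j}).prod)⁻¹ *
        (∑ w ∈ forestWords n 1, (w.map fun j => ν.real {j}).prod * (w.count r * w.count s)) -
      ((∑ w ∈ forestWords n 1, (w.map fun j => ν.real {j}).prod)⁻¹ *
        ∑ w ∈ forestWords n 1, (w.map fun j => ν.real {j}).prod * w.count r) *
      ((∑ w ∈ forestWords n 1, (w.map fun j => ν.real {j}).prod)⁻¹ *
        ∑ w ∈ forestWords n 1, (w.map fun j => ν.real {j}).prod * w.count s) := by
  have : IsProbabilityMeasure (condMeasure P ξ n) := cond_isProbabilityMeasure hn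
  have hX (r : ℕ) : ∀ w ∈ forestWords n 1, ∀ ω ∈ wordEvent ξ w,
      (numOutdegree r (gwTree ξ ω) : ℝ) = w.count r := fun w _ ω h => by
    rw [numOutdegree_gwTree h]
  rw [covariance_eq_sub (memLp_condMeasure hmeas (hX r)) (memLp_condMeasure hmeas (hX s)),
    integral_condMeasure hmeas hlaw hindep (hX r), integral_condMeasure hmeas hlaw hindep (hX s),
    integral_condMeasure hmeas hlaw hindep (φ := fun w => (w.count r : ℝ) * w.count s)]
  intro w hw ω hω
  rw [Pi.mul_apply, hX r w hw ω hω, hX s w hw ω hω]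

lemma variance_numOutdegree (hmeas : ∀ u, Measurable (ξ u)) (n r : ℕ) :
    Var[fun ω => (numOutdegree r (gwTree ξ ω) : ℝ); condMeasure P ξ n] =
      cov[fun ω => (numOutdegree r (gwTree ξ ω) : ℝ), fun ω => (numOutdegree r (gwTree ξ ω) : ℝ);
        condMeasure P ξ n] := by
  refine (covariance_self (memLp_condMeasure (φ := fun w => (w.count r : ℝ)) hmeas
    fun w _ ω h => ?_).aemeasurable).symm
  rw [numOutdegree_gwTree h]

end Law

/-! ### Laplace's method and Gaussian moments. -/

section Laplace

/-- A continuous function with a limit of `f t / t ^ k` at `0` is bounded by a multiple of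
`|t| ^ k` on compact intervals. -/
lemma exists_norm_le_mul_pow {f : ℝ → ℂ} (hf : Continuous f) {k : ℕ} {L : ℂ}
    (hL : Tendsto (fun t : ℝ => f t / (t : ℂ) ^ k) (𝓝[≠] 0) (𝓝 L)) (a : ℝ) :
    ∃ C, ∀ t, t ≠ 0 → |t| ≤ a → ‖f t‖ ≤ C * |t| ^ k := by
  set G : ℝ → ℂ := Function.update (fun t : ℝ => f t / (t : ℂ) ^ k) 0 L with hG
  have hc : Continuous G := by
    rw [continuous_iff_continuousAt]
    intro t
    rcases eq_or_ne t 0 with rfl | ht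
    · exact continuousAt_update_same.2 hL
    · rw [hG, continuousAt_update_of_ne ht]
      exact hf.continuousAt.div (by fun_prop) (by simpa using fun h => absurd h ht)
  obtain ⟨C, hC⟩ := (isCompact_Icc (a := -a) (b := a)).exists_bound_of_continuousOn hc.continuousOn
  refine ⟨C, fun t ht hta => ?_⟩
  have := hC t (abs_le.1 hta)
  rw [hG, Function.update_of_ne ht, norm_div, norm_pow, Complex.norm_real, Real.norm_eq_abs,
    div_le_iff₀ (by positivity)] at this
  exact this

variable {ψ : ℝ → ℂ} {v a : ℝ}

/-- The quotient (1 - |ψ|²)/t² extends continuously to 0 with value v > 0, so it has a positive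
minimum on [-a, a]. Then 1 - y ≤ e^{-y} bounds |ψ|², and the square root halves the constant. -/
lemma exists_norm_le_exp_neg (hψ : Continuous ψ) (hv : 0 < v) (ha : 0 < a)
    (hlim : Tendsto (fun t : ℝ => (ψ t - 1) / (t : ℂ) ^ 2) (𝓝[≠] 0) (𝓝 (-((v / 2 : ℝ) : ℂ))))
    (hlt : ∀ t, t ≠ 0 → |t| ≤ a → ‖ψ t‖ < 1) :
    ∃ c > 0, ∀ t, t ≠ 0 → |t| ≤ a → ‖ψ t‖ ≤ Real.exp (-c * t ^ 2) := by
  set H : ℝ → ℝ := fun t => (1 - ‖ψ t‖ ^ 2) / t ^ 2 with hH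
  have hHlim : Tendsto H (𝓝[≠] 0) (𝓝 v) := by
    have h1 : Tendsto (fun t : ℝ => -2 * ((ψ t - 1) / (t : ℂ) ^ 2).re -
        ‖(ψ t - 1) / (t : ℂ) ^ 2‖ ^ 2 * t ^ 2) (𝓝[≠] 0)
        (𝓝 (-2 * (-((v / 2 : ℝ) : ℂ)).re - ‖(-((v / 2 : ℝ) : ℂ))‖ ^ 2 * 0 ^ 2)) := by
      refine ((Complex.continuous_re.continuousAt.tendsto.comp hlim).const_mul _).sub
        ((hlim.norm.pow 2).mul ?_)
      exact ((continuous_id.tendsto (0 : ℝ)).mono_left nhdsWithin_le_nhds).pow 2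
    have h2 : -2 * (-((v / 2 : ℝ) : ℂ)).re - ‖(-((v / 2 : ℝ) : ℂ))‖ ^ 2 * 0 ^ 2 = v := by
      rw [Complex.neg_re, Complex.ofReal_re]
      ring
    rw [h2] at h1
    refine h1.congr' ?_
    filter_upwards [self_mem_nhdsWithin] with t ht
    have ht : t ≠ 0 := ht
    have htc : (t : ℂ) ≠ 0 := by exact_mod_cast ht
    have h3 : ψ t = 1 + (t ^ 2 : ℝ) * ((ψ t - 1) / (t : ℂ) ^ 2) := by
      push_cast
      field_simp
      ring
    rw [hH]
    dsimp only
    rw [h3]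
    generalize (ψ t - 1) / (t : ℂ) ^ 2 = z
    rw [add_sub_cancel_left]
    have h4 : ((t ^ 2 : ℝ) : ℂ) * z / (t : ℂ) ^ 2 = z := by
      push_cast
      field_simp
    rw [h4, ← Complex.normSq_eq_norm_sq, ← Complex.normSq_eq_norm_sq, Complex.normSq_apply,
      Complex.normSq_apply]
    simp only [Complex.add_re, Complex.one_re, Complex.re_ofReal_mul, Complex.add_im,
      Complex.one_im, Complex.im_ofReal_mul]
    field_simp
    ring
  set G : ℝ → ℝ := Function.update H 0 v with hG
  have hc : Continuous G := by
    rw [continuous_iff_continuousAt]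
    intro t
    rcases eq_or_ne t 0 with rfl | ht
    · exact continuousAt_update_same.2 hHlim
    · rw [hG, continuousAt_update_of_ne ht]
      exact ContinuousAt.div (by fun_prop) (by fun_prop) (by simpa using ht)
  obtain ⟨x, hx, hmin⟩ := (isCompact_Icc (a := -a) (b := a)).exists_isMinOn
    ⟨0, by simp [ha.le]⟩ hc.continuousOn
  have hGx : 0 < G x := by
    rcases eq_or_ne x 0 with rfl | hx0
    · rw [hG, Function.update_self]
      exact hv
    · rw [hG, Function.update_of_ne hx0]
      refine div_pos ?_ (by positivity)
      have := hlt x hx0 (abs_le.2 hx)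
      nlinarith [norm_nonneg (ψ x)]
  refine ⟨G x / 2, by positivity, fun t ht hta => ?_⟩
  have h1 : G x ≤ G t := hmin (abs_le.1 hta)
  rw [hG, Function.update_of_ne ht, ← hG] at h1
  rw [hH, le_div_iff₀ (by positivity)] at h1
  refine (sq_le_sq₀ (norm_nonneg _) (Real.exp_pos _).le).1 ?_
  rw [← Real.exp_nat_mul]
  have h2 := Real.add_one_le_exp (-(G x * t ^ 2))
  have h3 : ((2 : ℕ) : ℝ) * (-(G x / 2) * t ^ 2) = -(G x * t ^ 2) := by
    push_cast
    ring
  rw [h3]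
  linarith

lemma integrable_abs_pow_mul_exp_neg {c : ℝ} (hc : 0 < c) (k : ℕ) :
    Integrable fun x : ℝ => |x| ^ k * Real.exp (-c * x ^ 2) := by
  have h := (integrable_rpow_mul_exp_neg_mul_sq hc (s := k)
    (by have : (0 : ℝ) ≤ k := k.cast_nonneg; linarith)).norm
  refine h.congr (ae_of_all _ fun x => ?_)
  simp

lemma tendsto_pow_gaussian
    (hlim : Tendsto (fun t : ℝ => (ψ t - 1) / (t : ℂ) ^ 2) (𝓝[≠] 0) (𝓝 (-((v / 2 : ℝ) : ℂ))))
    {x : ℝ} (hx : x ≠ 0) :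
    Tendsto (fun m : ℕ => ψ (x / √m) ^ m) atTop (𝓝 (Real.exp (-(v / 2) * x ^ 2) : ℝ)) := by
  have hx0 : Tendsto (fun m : ℕ => x / √m) atTop (𝓝[≠] 0) := by
    refine tendsto_nhdsWithin_iff.2 ⟨?_, ?_⟩
    · exact tendsto_const_nhds.div_atTop (Real.tendsto_sqrt_atTop.comp tendsto_natCast_atTop_atTop)
    · filter_upwards [eventually_gt_atTop 0] with m hm
      have : 0 < √(m : ℝ) := Real.sqrt_pos.2 (by exact_mod_cast hm)
      exact div_ne_zero hx this.ne'
  have h1 : Tendsto (fun m : ℕ => (m : ℂ) * (ψ (x / √m) - 1)) atTop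
      (𝓝 (-((v / 2 : ℝ) : ℂ) * (x : ℂ) ^ 2)) := by
    refine ((hlim.comp hx0).mul_const ((x : ℂ) ^ 2)).congr' ?_
    filter_upwards [eventually_gt_atTop 0] with m hm
    have hm' : (0 : ℝ) < m := by exact_mod_cast hm
    have h2 : ((√(m : ℝ) : ℝ) : ℂ) ^ 2 = m := by
      rw [← Complex.ofReal_pow, Real.sq_sqrt hm'.le, Complex.ofReal_natCast]
    have h3 : (m : ℂ) ≠ 0 := by exact_mod_cast hm.ne'
    have h4 : (x : ℂ) ≠ 0 := by exact_mod_cast hx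
    simp only [Function.comp_apply]
    rw [Complex.ofReal_div, div_pow, h2]
    field_simp
  have h2 := Complex.tendsto_one_add_pow_exp_of_tendsto h1
  simp only [add_sub_cancel] at h2
  convert h2 using 2
  push_cast
  rfl

/-- Laplace's method for the integral of `ψ ^ m * f` over a neighbourhood of the maximum `0`
of `ψ`. -/
lemma tendsto_integral_pow_mul (hψ : Continuous ψ) (hv : 0 < v) (ha : 0 < a)
    (hlim : Tendsto (fun t : ℝ => (ψ t - 1) / (t : ℂ) ^ 2) (𝓝[≠] 0) (𝓝 (-((v / 2 : ℝ) : ℂ))))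
    (hlt : ∀ t, t ≠ 0 → |t| ≤ a → ‖ψ t‖ < 1)
    {f : ℝ → ℂ} (hf : Continuous f) {k : ℕ} {L : ℂ}
    (hL : Tendsto (fun t : ℝ => f t / (t : ℂ) ^ k) (𝓝[≠] 0) (𝓝 L)) :
    Tendsto (fun m : ℕ => (√m : ℂ) ^ (k + 1) * ∫ t in -a..a, ψ t ^ m * f t) atTop
      (𝓝 (L * (∫ x : ℝ, x ^ k * Real.exp (-(v / 2) * x ^ 2) : ℝ))) := by
  obtain ⟨c, hc, hψc⟩ := exists_norm_le_exp_neg hψ hv ha hlim hlt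
  obtain ⟨C, hC⟩ := exists_norm_le_mul_pow hf hL a
  have hC0 : 0 ≤ C := by
    have := (norm_nonneg _).trans (hC a ha.ne' (abs_of_pos ha).le)
    exact nonneg_of_mul_nonneg_left this (by positivity)
  -- The integral after substituting t = x/√m; the integrand is dominated by C |x|^k e^{-cx²},
  -- uniformly in m > 0.
  have hdct : Tendsto (fun m : ℕ => ∫ x : ℝ, (Set.Ioc (-(a * √m)) (a * √m)).indicator
      (fun x => (√m : ℂ) ^ k * (ψ (x / √m) ^ m * f (x / √m))) x) atTop
      (𝓝 (∫ x : ℝ, L * ((x ^ k * Real.exp (-(v / 2) * x ^ 2) : ℝ) : ℂ))) := by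
    refine tendsto_integral_filter_of_dominated_convergence
      (fun x => C * (|x| ^ k * Real.exp (-c * x ^ 2))) ?_ ?_
      ((integrable_abs_pow_mul_exp_neg hc k).const_mul C) ?_
    · refine Eventually.of_forall fun m => ?_
      refine (Continuous.aestronglyMeasurable ?_).indicator measurableSet_Ioc
      fun_prop
    · filter_upwards [eventually_gt_atTop 0] with m hm
      have hm' : (0 : ℝ) < m := by exact_mod_cast hm
      have hs : 0 < √(m : ℝ) := Real.sqrt_pos.2 hm'
      filter_upwards [compl_mem_ae_iff.2 (measure_singleton (0 : ℝ))] with x hx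
      have hx : x ≠ 0 := hx
      by_cases hxm : x ∈ Set.Ioc (-(a * √m)) (a * √m)
      · rw [Set.indicator_of_mem hxm]
        have h1 : x / √m ≠ 0 := div_ne_zero hx hs.ne'
        have h2 : |x / √m| ≤ a := by
          rw [abs_div, abs_of_pos hs, div_le_iff₀ hs]
          exact abs_le.2 ⟨hxm.1.le, hxm.2⟩
        rw [norm_mul, norm_mul, norm_pow, norm_pow, Complex.norm_real, Real.norm_eq_abs,
          abs_of_pos hs]
        have h3 : ‖ψ (x / √m)‖ ^ m ≤ Real.exp (-c * x ^ 2) := by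
          refine (pow_le_pow_left₀ (norm_nonneg _) (hψc _ h1 h2) m).trans ?_
          rw [← Real.exp_nat_mul, div_pow, Real.sq_sqrt hm'.le]
          refine le_of_eq ?_
          congr 1
          field_simp
        calc √m ^ k * (‖ψ (x / √m)‖ ^ m * ‖f (x / √m)‖)
            ≤ √m ^ k * (Real.exp (-c * x ^ 2) * (C * |x / √m| ^ k)) := by
              gcongr
              exact hC _ h1 h2
          _ = C * (|x| ^ k * Real.exp (-c * x ^ 2)) := by
              rw [abs_div, abs_of_pos hs, div_pow]
              field_simp
      · rw [Set.indicator_of_notMem hxm, norm_zero]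
        positivity
    · filter_upwards [compl_mem_ae_iff.2 (measure_singleton (0 : ℝ))] with x hx
      have hx : x ≠ 0 := hx
      have hsq : Tendsto (fun m : ℕ => √(m : ℝ)) atTop atTop :=
        Real.tendsto_sqrt_atTop.comp tendsto_natCast_atTop_atTop
      have hx0 : Tendsto (fun m : ℕ => x / √m) atTop (𝓝[≠] 0) := by
        refine tendsto_nhdsWithin_iff.2 ⟨tendsto_const_nhds.div_atTop hsq, ?_⟩
        filter_upwards [hsq.eventually_gt_atTop 0] with m hm
        exact div_ne_zero hx hm.ne'
      have h1 := ((hL.comp hx0).mul_const ((x : ℂ) ^ k)).mul (tendsto_pow_gaussian hlim hx)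
      have h2 : L * ((x ^ k * Real.exp (-(v / 2) * x ^ 2) : ℝ) : ℂ) =
          L * (x : ℂ) ^ k * (Real.exp (-(v / 2) * x ^ 2) : ℝ) := by
        push_cast
        ring
      rw [h2]
      refine h1.congr' ?_
      filter_upwards [(hsq.const_mul_atTop ha).eventually_gt_atTop |x|,
        hsq.eventually_gt_atTop 0] with m hm hs
      have hm : |x| < √m * a := by linarith
      rw [Set.indicator_of_mem (Set.mem_Ioc.2 ⟨by linarith [(abs_lt.1 hm).1],
        by linarith [(abs_lt.1 hm).2]⟩)]
      have h3 : ((√(m : ℝ) : ℝ) : ℂ) ≠ 0 := by exact_mod_cast hs.ne'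
      have h4 : (x : ℂ) ≠ 0 := by exact_mod_cast hx
      simp only [Function.comp_apply]
      rw [Complex.ofReal_div, div_pow]
      field_simp
  rw [integral_const_mul, integral_complex_ofReal] at hdct
  refine hdct.congr' ?_
  filter_upwards [eventually_gt_atTop 0] with m hm
  have hs : 0 < √(m : ℝ) := Real.sqrt_pos.2 (by exact_mod_cast hm)
  rw [integral_indicator measurableSet_Ioc, ← intervalIntegral.integral_of_le (by nlinarith),
    intervalIntegral.integral_const_mul,
    intervalIntegral.integral_comp_div (fun t => ψ t ^ m * f t) hs.ne', neg_div,
    mul_div_cancel_right₀ _ hs.ne', Complex.real_smul]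
  ring

/-- Integration by parts. Only this ratio of Gaussian moments is needed, since the zeroth moment
cancels in the end. -/
lemma integral_sq_mul_gaussian (hv : 0 < v) :
    v * ∫ x : ℝ, x ^ 2 * Real.exp (-(v / 2) * x ^ 2) =
      ∫ x : ℝ, x ^ 0 * Real.exp (-(v / 2) * x ^ 2) := by
  have hi (k : ℕ) : Integrable fun x : ℝ => x ^ k * Real.exp (-(v / 2) * x ^ 2) := by
    have h := integrable_abs_pow_mul_exp_neg (half_pos hv) k
    refine h.mono' (by fun_prop) (ae_of_all _ fun x => le_of_eq ?_)
    rw [norm_mul, norm_pow, Real.norm_eq_abs, Real.norm_eq_abs, abs_of_pos (Real.exp_pos _)]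
  have h := integral_mul_deriv_eq_deriv_mul_of_integrable (u := fun x : ℝ => x) (u' := fun _ => 1)
    (v := fun x => Real.exp (-(v / 2) * x ^ 2))
    (v' := fun x => -v * (x ^ 1 * Real.exp (-(v / 2) * x ^ 2)))
    (fun x _ => hasDerivAt_id x) (fun x _ => ?_) ?_ ?_ ?_
  · have e : (fun x : ℝ => x * (-v * (x ^ 1 * Real.exp (-(v / 2) * x ^ 2)))) =
        fun x => -v * (x ^ 2 * Real.exp (-(v / 2) * x ^ 2)) := by
      ext x
      ring
    rw [e, integral_const_mul] at h
    simp only [pow_zero]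
    linarith
  · have h1 := ((hasDerivAt_pow 2 x).const_mul (-(v / 2))).exp
    refine h1.congr_deriv ?_
    push_cast
    ring
  · refine ((hi 2).const_mul (-v)).congr (ae_of_all _ fun x => ?_)
    simp only [Pi.mul_apply]
    ring
  · refine (hi 0).congr (ae_of_all _ fun x => ?_)
    simp
  · refine (hi 1).congr (ae_of_all _ fun x => ?_)
    simp

lemma integral_mul_gaussian (v : ℝ) : ∫ x : ℝ, x ^ 1 * Real.exp (-(v / 2) * x ^ 2) = 0 := by
  have h := integral_neg_eq_self (fun x : ℝ => x ^ 1 * Real.exp (-(v / 2) * x ^ 2)) volume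
  have e : (fun x : ℝ => (-x) ^ 1 * Real.exp (-(v / 2) * (-x) ^ 2)) =
      fun x => -(x ^ 1 * Real.exp (-(v / 2) * x ^ 2)) := by
    ext x
    simp
  rw [e, integral_neg] at h
  linarith

lemma integral_gaussian_pos (hv : 0 < v) :
    0 < ∫ x : ℝ, x ^ 0 * Real.exp (-(v / 2) * x ^ 2) := by
  simp only [pow_zero, one_mul]
  rw [integral_gaussian]
  positivity

lemma tendsto_exp_sub_div_sq (b : ℝ) :
    Tendsto (fun t : ℝ => (Complex.exp (b * t * Complex.I) - 1 - b * t * Complex.I) /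
      (t : ℂ) ^ 2) (𝓝[≠] 0) (𝓝 (-((b ^ 2 / 2 : ℝ) : ℂ))) := by
  have h := (Complex.exp_sub_sum_range_succ_isLittleO_pow 2).comp_tendsto
    (k := fun t : ℝ => (b * t * Complex.I : ℂ)) (l' := 𝓝[≠] (0 : ℝ)) (by
      have : Continuous fun t : ℝ => (b * t * Complex.I : ℂ) := by fun_prop
      simpa using (this.tendsto 0).mono_left nhdsWithin_le_nhds)
  have h1 : (fun t : ℝ => (b * t * Complex.I : ℂ) ^ 2) =O[𝓝[≠] 0] fun t : ℝ => (t : ℂ) ^ 2 := by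
    have : (fun t : ℝ => (b * t * Complex.I : ℂ) ^ 2) =
        fun t : ℝ => -(b : ℂ) ^ 2 * (t : ℂ) ^ 2 := by
      ext t
      rw [mul_pow, mul_pow, Complex.I_sq]
      ring
    rw [this]
    exact Asymptotics.isBigO_const_mul_self _ _ _
  have h2 := ((h.trans_isBigO h1).tendsto_div_nhds_zero).add_const (-((b ^ 2 / 2 : ℝ) : ℂ))
  rw [zero_add] at h2
  refine h2.congr' ?_
  filter_upwards [self_mem_nhdsWithin] with t ht
  have ht : (t : ℂ) ≠ 0 := by exact_mod_cast ht
  simp only [Function.comp_apply, Finset.sum_range_succ, Finset.range_one, Finset.sum_singleton]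
  simp only [mul_pow, Complex.I_sq]
  field_simp
  simp [Nat.factorial]
  ring

end Laplace

/-! ### Second-order asymptotics of the Fourier integrals. -/

section SecondOrder

variable {ψ : ℝ → ℂ} {v a : ℝ}

lemma tendsto_pow_sub_one_div_sq
    (hlim : Tendsto (fun t : ℝ => (ψ t - 1) / (t : ℂ) ^ 2) (𝓝[≠] 0) (𝓝 (-((v / 2 : ℝ) : ℂ))))
    (hψ : Continuous ψ) (hψ0 : ψ 0 = 1) (j : ℕ) :
    Tendsto (fun t : ℝ => (ψ t ^ j - 1) / (t : ℂ) ^ 2) (𝓝[≠] 0)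
      (𝓝 (-((j * v / 2 : ℝ) : ℂ))) := by
  induction j with
  | zero => simp
  | succ j ih =>
    have h1 : Tendsto ψ (𝓝[≠] 0) (𝓝 1) := by
      rw [← hψ0]
      exact (hψ.tendsto 0).mono_left nhdsWithin_le_nhds
    convert (ih.mul h1).add hlim using 2 with t
    · ring
    · push_cast
      ring

/-- The second-order remainder of `ψ ^ j * exp (b * t * I)` at `0`. -/
lemma tendsto_remainder_div_sq
    (hlim : Tendsto (fun t : ℝ => (ψ t - 1) / (t : ℂ) ^ 2) (𝓝[≠] 0) (𝓝 (-((v / 2 : ℝ) : ℂ))))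
    (hψ : Continuous ψ) (hψ0 : ψ 0 = 1) (j : ℕ) (b : ℝ) :
    Tendsto (fun t : ℝ => (ψ t ^ j * Complex.exp (b * t * Complex.I) - 1 - b * t * Complex.I) /
      (t : ℂ) ^ 2) (𝓝[≠] 0) (𝓝 (-(((j * v + b ^ 2) / 2 : ℝ) : ℂ))) := by
  have h1 : Tendsto (fun t : ℝ => Complex.exp (b * t * Complex.I)) (𝓝[≠] 0) (𝓝 1) := by
    have : Continuous fun t : ℝ => Complex.exp (b * t * Complex.I) := by fun_prop
    simpa using (this.tendsto 0).mono_left nhdsWithin_le_nhds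
  convert ((tendsto_pow_sub_one_div_sq hlim hψ hψ0 j).mul h1).add (tendsto_exp_sub_div_sq b)
    using 2 with t
  · ring
  · push_cast
    ring

/-- The integral of `ψ ^ (m + j) * exp (b * t * I)` over `[-a, a]`. -/
noncomputable def oscInt (ψ : ℝ → ℂ) (a : ℝ) (j : ℕ) (b : ℝ) (m : ℕ) : ℂ :=
  ∫ t in -a..a, ψ t ^ m * (ψ t ^ j * Complex.exp (b * t * Complex.I))

lemma oscInt_eq (hψ : Continuous ψ) (j : ℕ) (b : ℝ) (m : ℕ) :
    oscInt ψ a j b m = (∫ t in -a..a, ψ t ^ m * 1) +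
      b * Complex.I * (∫ t in -a..a, ψ t ^ m * (t : ℂ)) +
      ∫ t in -a..a, ψ t ^ m *
        (ψ t ^ j * Complex.exp (b * t * Complex.I) - 1 - b * t * Complex.I) := by
  rw [oscInt, ← intervalIntegral.integral_const_mul, ← intervalIntegral.integral_add,
    ← intervalIntegral.integral_add]
  · congr 1
    ext t
    ring
  all_goals
    refine Continuous.intervalIntegrable ?_ _ _
    fun_prop

/-- The function `ψ` is continuous, behaves like `1 - v * t ^ 2 / 2` at `0`, and has modulus less
than `1` on the rest of `[-a, a]`. -/
structure HasQuadraticMax (ψ : ℝ → ℂ) (v a : ℝ) : Prop where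
  continuous : Continuous ψ
  zero : ψ 0 = 1
  variance_pos : 0 < v
  radius_pos : 0 < a
  tendsto : Tendsto (fun t : ℝ => (ψ t - 1) / (t : ℂ) ^ 2) (𝓝[≠] 0) (𝓝 (-((v / 2 : ℝ) : ℂ)))
  norm_lt : ∀ t, t ≠ 0 → |t| ≤ a → ‖ψ t‖ < 1

lemma HasQuadraticMax.tendsto_integral (h : HasQuadraticMax ψ v a) {f : ℝ → ℂ}
    (hf : Continuous f) {k : ℕ} {L : ℂ}
    (hL : Tendsto (fun t : ℝ => f t / (t : ℂ) ^ k) (𝓝[≠] 0) (𝓝 L)) :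
    Tendsto (fun m : ℕ => (√m : ℂ) ^ (k + 1) * ∫ t in -a..a, ψ t ^ m * f t) atTop
      (𝓝 (L * (∫ x : ℝ, x ^ k * Real.exp (-(v / 2) * x ^ 2) : ℝ))) :=
  tendsto_integral_pow_mul h.continuous h.variance_pos h.radius_pos h.tendsto h.norm_lt hf hL

lemma HasQuadraticMax.tendsto_oscInt (h : HasQuadraticMax ψ v a) (j : ℕ) (b : ℝ) :
    Tendsto (fun m : ℕ => (√m : ℂ) * oscInt ψ a j b m) atTop
      (𝓝 (∫ x : ℝ, x ^ 0 * Real.exp (-(v / 2) * x ^ 2) : ℝ)) := by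
  have hψ := h.continuous
  have hc : Continuous fun t : ℝ => ψ t ^ j * Complex.exp (b * t * Complex.I) := by fun_prop
  have := h.tendsto_integral (k := 0) (L := 1) hc (by
    simpa [h.zero] using (hc.tendsto 0).mono_left nhdsWithin_le_nhds)
  simpa only [zero_add, pow_one, one_mul, oscInt] using this

/-- Split each integral as A + ibB + Q, from ψ^j e^{ibt} = 1 + ibt + O(t²). Here A is of order
m^{-1/2}, B = o(1/m) because the Gaussian is even, and Q = O(m^{-3/2}). The A² and AB terms cancel,
and B² = o(m^{-2}). In the A Q terms the contributions of j cancel, and 1 + (r+s-1)² - r² - s² =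
2(r-1)(s-1) gives the limit. -/
lemma HasQuadraticMax.tendsto_det_oscInt (h : HasQuadraticMax ψ v a) (r s : ℝ) :
    Tendsto (fun m : ℕ => (m : ℂ) ^ 2 * (oscInt ψ a 2 1 m * oscInt ψ a 0 (r + s - 1) m -
      oscInt ψ a 1 r m * oscInt ψ a 1 s m)) atTop
      (𝓝 (-((r - 1) * (s - 1) / v *
        (∫ x : ℝ, x ^ 0 * Real.exp (-(v / 2) * x ^ 2)) ^ 2 : ℝ))) := by
  have hψ := h.continuous
  set c : ℝ := ∫ x : ℝ, x ^ 0 * Real.exp (-(v / 2) * x ^ 2) with hc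
  have hA := h.tendsto_integral (k := 0) (L := 1) (f := fun _ => 1) (by fun_prop) (by simp)
  have hB := h.tendsto_integral (k := 1) (L := 1) (f := fun t => (t : ℂ)) (by fun_prop) (by
    refine tendsto_const_nhds.congr' ?_
    filter_upwards [self_mem_nhdsWithin] with t ht
    have ht : (t : ℂ) ≠ 0 := by exact_mod_cast ht
    rw [pow_one, div_self ht])
  have hQ (j : ℕ) (b : ℝ) := h.tendsto_integral (k := 2) (by fun_prop)
    (tendsto_remainder_div_sq h.tendsto hψ h.zero j b)
  have hc2 : ∫ x : ℝ, x ^ 2 * Real.exp (-(v / 2) * x ^ 2) = c / v := by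
    rw [eq_div_iff h.variance_pos.ne', mul_comm, integral_sq_mul_gaussian h.variance_pos]
  rw [integral_mul_gaussian] at hB
  simp only [hc2] at hQ
  rw [← hc] at hA
  have he : Tendsto (fun m : ℕ => ((√(m : ℝ))⁻¹ : ℂ)) atTop (𝓝 0) := by
    have h0 : Tendsto (fun m : ℕ => (√(m : ℝ))⁻¹) atTop (𝓝 0) :=
      tendsto_inv_atTop_zero.comp (Real.tendsto_sqrt_atTop.comp tendsto_natCast_atTop_atTop)
    have h1 := (Complex.continuous_ofReal.tendsto 0).comp h0
    simpa [Function.comp_def] using h1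
  -- The four summands are the A Q, B², B Q and Q Q terms; the last two carry extra factors m^{-1/2}
  -- and m^{-1}.
  have key := (((hA.mul (((hQ 2 1).add (hQ 0 (r + s - 1))).sub ((hQ 1 r).add (hQ 1 s)))).add
    ((hB.pow 2).mul_const ((r * s - (r + s - 1) : ℝ) : ℂ))).add
    ((he.mul_const Complex.I).mul (hB.mul (((hQ 0 (r + s - 1)).add
      ((hQ 2 1).const_mul ((r + s - 1 : ℝ) : ℂ))).sub (((hQ 1 s).const_mul (r : ℂ)).add
      ((hQ 1 r).const_mul (s : ℂ))))))).add
    ((he.pow 2).mul (((hQ 2 1).mul (hQ 0 (r + s - 1))).sub ((hQ 1 r).mul (hQ 1 s))))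
  refine (key.congr' ?_).trans (le_of_eq ?_)
  · filter_upwards [eventually_gt_atTop 0] with m hm
    have hm' : (0 : ℝ) < m := by exact_mod_cast hm
    have h1 : ((√(m : ℝ) : ℝ) : ℂ) ≠ 0 := by exact_mod_cast (Real.sqrt_pos.2 hm').ne'
    have h2 : (m : ℂ) = ((√(m : ℝ) : ℝ) : ℂ) ^ 2 := by
      rw [← Complex.ofReal_pow, Real.sq_sqrt hm'.le, Complex.ofReal_natCast]
    rw [h2, oscInt_eq hψ 2, oscInt_eq hψ 0, oscInt_eq hψ 1 r, oscInt_eq hψ 1 s]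
    generalize ((√(m : ℝ) : ℝ) : ℂ) = x at *
    generalize (∫ t in -a..a, ψ t ^ m * 1) = A
    generalize (∫ t in -a..a, ψ t ^ m * (t : ℂ)) = B
    generalize (∫ t in -a..a, ψ t ^ m *
        (ψ t ^ 2 * Complex.exp ((1 : ℝ) * t * Complex.I) - 1 - (1 : ℝ) * t * Complex.I)) = Q0
    generalize (∫ t in -a..a, ψ t ^ m *
        (ψ t ^ 1 * Complex.exp (r * t * Complex.I) - 1 - r * t * Complex.I)) = Q1
    generalize (∫ t in -a..a, ψ t ^ m *
        (ψ t ^ 1 * Complex.exp (s * t * Complex.I) - 1 - s * t * Complex.I)) = Q2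
    generalize (∫ t in -a..a, ψ t ^ m *
        (ψ t ^ 0 * Complex.exp ((r + s - 1 : ℝ) * t * Complex.I) - 1 -
          (r + s - 1 : ℝ) * t * Complex.I)) = Q3
    push_cast
    field_simp
    linear_combination (-(r + s - 1 - r * s) * B ^ 2) * Complex.I_sq
  · congr 1
    push_cast
    have : (v : ℂ) ≠ 0 := by exact_mod_cast h.variance_pos.ne'
    field_simp
    ring

end SecondOrder

/-! ### Power series on the unit circle and Fourier inversion. -/

section Evaluation

open PowerSeries

/-- The power series converges absolutely on the closed unit disc. -/
def AbsSummable (h : PowerSeries ℝ) : Prop := Summable fun k => |coeff k h|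

/-- The value at `z` of a power series with real coefficients. -/
noncomputable def evalAt (h : PowerSeries ℝ) (z : ℂ) : ℂ := ∑' k, ((coeff k h : ℝ) : ℂ) * z ^ k

lemma AbsSummable.summable_norm {h : PowerSeries ℝ} (hh : AbsSummable h) {z : ℂ} (hz : ‖z‖ = 1) :
    Summable fun k => ‖((coeff k h : ℝ) : ℂ) * z ^ k‖ := by
  simpa [hz] using! hh

lemma AbsSummable.mul {f g : PowerSeries ℝ} (hf : AbsSummable f) (hg : AbsSummable g) :
    AbsSummable (f * g) := by
  have := summable_norm_sum_mul_antidiagonal_of_summable_norm (f := fun k => coeff k f)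
    (g := fun k => coeff k g) (by simpa using! hf) (by simpa using! hg)
  simpa [AbsSummable, coeff_mul] using this

lemma evalAt_mul {f g : PowerSeries ℝ} (hf : AbsSummable f) (hg : AbsSummable g) {z : ℂ}
    (hz : ‖z‖ = 1) : evalAt (f * g) z = evalAt f z * evalAt g z := by
  rw [evalAt, evalAt, evalAt, tsum_mul_tsum_eq_tsum_sum_antidiagonal_of_summable_norm
    (hf.summable_norm hz) (hg.summable_norm hz)]
  refine tsum_congr fun k => ?_
  rw [coeff_mul, Complex.ofReal_sum, Finset.sum_mul]
  refine Finset.sum_congr rfl fun x hx => ?_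
  rw [← Finset.HasAntidiagonal.mem_antidiagonal.1 hx, pow_add]
  push_cast
  ring

lemma absSummable_X_pow (r : ℕ) : AbsSummable (X ^ r) := by
  refine summable_of_ne_finset_zero (s := {r}) fun k hk => ?_
  rw [coeff_X_pow, if_neg (by simpa using hk), abs_zero]

lemma evalAt_X_pow (r : ℕ) (z : ℂ) : evalAt (X ^ r) z = z ^ r := by
  rw [evalAt, tsum_eq_single r fun k hk => by rw [coeff_X_pow, if_neg hk]; simp]
  simp

lemma AbsSummable.pow {f : PowerSeries ℝ} (hf : AbsSummable f) (N : ℕ) : AbsSummable (f ^ N) := by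
  induction N with
  | zero => simpa using absSummable_X_pow 0
  | succ N ih => simpa [pow_succ] using ih.mul hf

lemma evalAt_pow {f : PowerSeries ℝ} (hf : AbsSummable f) {z : ℂ} (hz : ‖z‖ = 1) (N : ℕ) :
    evalAt (f ^ N) z = evalAt f z ^ N := by
  induction N with
  | zero => simpa using evalAt_X_pow 0 z
  | succ N ih => rw [pow_succ, evalAt_mul (hf.pow N) hf hz, ih, pow_succ]

/-- All exponents of the power series are multiples of `d`. -/
def SupportedOn (d : ℕ) (h : PowerSeries ℝ) : Prop := ∀ k, ¬ d ∣ k → coeff k h = 0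

lemma SupportedOn.mul {d : ℕ} {f g : PowerSeries ℝ} (hf : SupportedOn d f)
    (hg : SupportedOn d g) : SupportedOn d (f * g) := by
  intro k hk
  rw [coeff_mul]
  refine Finset.sum_eq_zero fun x hx => ?_
  by_cases h1 : d ∣ x.1
  · rw [hg x.2 fun h2 => hk (Finset.HasAntidiagonal.mem_antidiagonal.1 hx ▸ dvd_add h1 h2),
      mul_zero]
  · rw [hf x.1 h1, zero_mul]

lemma supportedOn_X_pow {d r : ℕ} (h : d ∣ r) : SupportedOn d (X ^ r) := by
  intro k hk
  rw [coeff_X_pow, if_neg]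
  rintro rfl
  exact hk h

lemma SupportedOn.pow {d : ℕ} {f : PowerSeries ℝ} (hf : SupportedOn d f) (N : ℕ) :
    SupportedOn d (f ^ N) := by
  induction N with
  | zero => simpa using supportedOn_X_pow (dvd_zero d)
  | succ N ih => simpa [pow_succ] using ih.mul hf

/-- On an arc of length 2π/d, characters with frequencies divisible by d are orthogonal. The shorter
arc is chosen to leave 0 as the only point where |ψ| = 1. -/
lemma integral_exp_int_mul {d : ℕ} (hd : 0 < d) (l : ℤ) :
    ∫ t in -(Real.pi / d)..Real.pi / d, Complex.exp ((d * l : ℂ) * Complex.I * (t : ℂ)) =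
      if l = 0 then (2 * Real.pi / d : ℂ) else 0 := by
  have hd' : (d : ℂ) ≠ 0 := by exact_mod_cast hd.ne'
  split_ifs with h
  · subst h
    simp
    ring
  · have hl : (l : ℂ) ≠ 0 := by exact_mod_cast h
    rw [integral_exp_mul_complex (mul_ne_zero (mul_ne_zero hd' hl) Complex.I_ne_zero),
      div_eq_zero_iff, sub_eq_zero]
    left
    rw [Complex.exp_eq_exp_iff_exists_int]
    refine ⟨l, ?_⟩
    push_cast
    field_simp
    ring

/-- Fourier inversion for the coefficients of a power series in `X ^ d`. -/
lemma integral_evalAt {h : PowerSeries ℝ} (hh : AbsSummable h) {d : ℕ} (hd : 0 < d)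
    (hs : SupportedOn d h) {m : ℕ} (hm : d ∣ m) :
    ∫ t in -(Real.pi / d)..Real.pi / d,
      evalAt h (Complex.exp (t * Complex.I)) * Complex.exp (-(m * t * Complex.I)) =
        2 * Real.pi / d * coeff m h := by
  have hsum := intervalIntegral.hasSum_integral_of_dominated_convergence
    (a := -(Real.pi / d)) (b := Real.pi / d) (μ := volume)
    (F := fun k (t : ℝ) => ((coeff k h : ℝ) : ℂ) * Complex.exp (t * Complex.I) ^ k *
      Complex.exp (-(m * t * Complex.I)))
    (f := fun t => evalAt h (Complex.exp (t * Complex.I)) * Complex.exp (-(m * t * Complex.I)))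
    (fun k _ => |coeff k h|) ?_ ?_ ?_ ?_ ?_
  · refine (hsum.unique ?_)
    have hterm (k : ℕ) : ∫ t in -(Real.pi / d)..Real.pi / d,
        ((coeff k h : ℝ) : ℂ) * Complex.exp (t * Complex.I) ^ k *
          Complex.exp (-(m * t * Complex.I)) =
        if k = m then (2 * Real.pi / d * coeff m h : ℂ) else 0 := by
      by_cases hk : d ∣ k
      · obtain ⟨i, rfl⟩ := hk
        obtain ⟨j, rfl⟩ := hm
        have e : (fun t : ℝ => ((coeff (d * i) h : ℝ) : ℂ) * Complex.exp (t * Complex.I) ^ (d * i) *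
            Complex.exp (-((d * j : ℕ) * t * Complex.I))) =
            fun t : ℝ => ((coeff (d * i) h : ℝ) : ℂ) *
              Complex.exp ((d * ((i - j : ℤ) : ℤ) : ℂ) * Complex.I * (t : ℂ)) := by
          ext t
          rw [mul_assoc, ← Complex.exp_nat_mul, ← Complex.exp_add]
          congr 2
          push_cast
          ring
        rw [e, intervalIntegral.integral_const_mul, integral_exp_int_mul hd]
        by_cases hij : i = j
        · subst hij
          simp
          ring
        · rw [if_neg (by omega), if_neg (by simp [hij, hd.ne'])]
          simp
      · rw [if_neg (by rintro rfl; exact hk hm), hs k hk]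
        simp
    simp_rw [hterm]
    exact hasSum_ite_eq m _
  · intro k
    refine Continuous.aestronglyMeasurable ?_
    fun_prop
  · intro k
    refine ae_of_all _ fun t _ => ?_
    have h1 : ‖Complex.exp (-(m * t * Complex.I))‖ = 1 := by
      have : -(m * t * Complex.I) = ((-(m * t) : ℝ) : ℂ) * Complex.I := by push_cast; ring
      rw [this, Complex.norm_exp_ofReal_mul_I]
    rw [norm_mul, norm_mul, norm_pow, h1, Complex.norm_exp_ofReal_mul_I]
    simp
  · exact ae_of_all _ fun t _ => hh
  · exact intervalIntegrable_const
  · refine ae_of_all _ fun t _ => HasSum.mul_right _ ?_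
    exact (hh.summable_norm (Complex.norm_exp_ofReal_mul_I t)).of_norm.hasSum

end Evaluation

/-! ### The span of the offspring distribution. -/

section Span

/-- If a probability generating function has modulus one at a point `z` of the unit circle,
then `z ^ k = 1` for all `k` in the support. -/
lemma pow_eq_one_of_norm_eq_one {p : ℕ → ℝ} (hp : ∀ k, 0 ≤ p k) (hp1 : HasSum p 1)
    (hp0 : p 0 ≠ 0) {z w : ℂ} (hz : ‖z‖ = 1) (hw : HasSum (fun k => (p k : ℂ) * z ^ k) w)
    (hw1 : 1 ≤ ‖w‖) {k : ℕ} (hk : p k ≠ 0) : z ^ k = 1 := by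
  have hwle : ‖w‖ ≤ 1 := by
    rw [← hw.tsum_eq, ← hp1.tsum_eq]
    refine (norm_tsum_le_tsum_norm ?_).trans (le_of_eq (tsum_congr fun k => ?_))
    · simpa [hz, abs_of_nonneg (hp _)] using hp1.summable
    · simp [hz, abs_of_nonneg (hp _)]
  have hwn : ‖w‖ = 1 := le_antisymm hwle hw1
  have hn (k : ℕ) : ‖(starRingEnd ℂ) w * z ^ k‖ = 1 := by simp [hz, hwn]
  have hre (k : ℕ) : ((starRingEnd ℂ) w * z ^ k).re ≤ 1 := (Complex.re_le_norm _).trans (hn k).le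
  -- Equality case of the triangle inequality: a nonnegative quantity with zero p-average vanishes
  -- on the support.
  have h1 : HasSum (fun k => p k * (1 - ((starRingEnd ℂ) w * z ^ k).re)) 0 := by
    have h2 := Complex.hasSum_re (hw.mul_left ((starRingEnd ℂ) w))
    have h3 : ((starRingEnd ℂ) w * w).re = 1 := by
      rw [← Complex.normSq_eq_conj_mul_self, Complex.ofReal_re, Complex.normSq_eq_norm_sq, hwn]
      norm_num
    rw [h3] at h2
    have h4 := hp1.sub h2
    rw [sub_self] at h4
    refine h4.congr_fun fun k => ?_
    rw [mul_left_comm, Complex.re_ofReal_mul]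
    ring
  have h5 := (hasSum_zero_iff_of_nonneg fun k =>
    mul_nonneg (hp k) (sub_nonneg.2 (hre k))).1 h1
  have h6 (k : ℕ) (hk : p k ≠ 0) : (starRingEnd ℂ) w * z ^ k = 1 := by
    have h7 : ((starRingEnd ℂ) w * z ^ k).re = 1 := by
      have := congrFun h5 k
      simp only [Pi.zero_apply, mul_eq_zero, hk, false_or] at this
      linarith
    have h8 := Complex.re_eq_norm.1 (h7.trans (hn k).symm)
    rw [Complex.eq_re_of_ofReal_le h8, h7, Complex.ofReal_one]
  -- Because 0 is in the support, the common phase is 1.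
  have h9 := h6 0 hp0
  rw [pow_zero, mul_one] at h9
  have := h6 k hk
  rwa [h9, one_mul] at this

/-- Take d to generate the subgroup of ℤ spanned by the support. Modulus one at e^{it} puts kt in
2πℤ for each k in the support, hence also dt; with |dt| ≤ π this forces t = 0. -/
lemma exists_span {p : ℕ → ℝ} (hp : ∀ k, 0 ≤ p k) (hp1 : HasSum p 1)
    (hp0 : p 0 ≠ 0) (hpk : ∃ k, k ≠ 0 ∧ p k ≠ 0) :
    ∃ d : ℕ, 0 < d ∧ (∀ k, p k ≠ 0 → d ∣ k) ∧ ∀ t : ℝ, t ≠ 0 → |t| ≤ Real.pi / d →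
      ∀ w : ℂ, HasSum (fun k => (p k : ℂ) * Complex.exp (t * Complex.I) ^ k) w → ‖w‖ < 1 := by
  obtain ⟨a, ha⟩ := Int.subgroup_cyclic
    (AddSubgroup.closure {l : ℤ | ∃ k : ℕ, p k ≠ 0 ∧ l = k})
  have hdvd (k : ℕ) (hk : p k ≠ 0) : a.natAbs ∣ k := by
    have : (k : ℤ) ∈ AddSubgroup.closure {a} := ha ▸ AddSubgroup.subset_closure ⟨k, hk, rfl⟩
    rw [← AddSubgroup.zmultiples_eq_closure, Int.mem_zmultiples_iff] at this
    exact Int.natAbs_dvd_natAbs.2 this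
  have hd : 0 < a.natAbs := by
    obtain ⟨k, hk0, hk⟩ := hpk
    exact Nat.pos_of_dvd_of_pos (hdvd k hk) (Nat.pos_of_ne_zero hk0)
  refine ⟨a.natAbs, hd, hdvd, fun t ht hta w hw => ?_⟩
  by_contra! hw1
  have hle : AddSubgroup.closure {l : ℤ | ∃ k : ℕ, p k ≠ 0 ∧ l = k} ≤
      AddSubgroup.comap (zmultiplesHom ℝ t) (AddSubgroup.zmultiples (2 * Real.pi)) := by
    rw [AddSubgroup.closure_le]
    rintro _ ⟨k, hk, rfl⟩
    have h1 := pow_eq_one_of_norm_eq_one hp hp1 hp0 (Complex.norm_exp_ofReal_mul_I t) hw hw1 hk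
    rw [← Complex.exp_nat_mul, Complex.exp_eq_one_iff] at h1
    obtain ⟨n, hn⟩ := h1
    refine AddSubgroup.mem_zmultiples_iff.2 ⟨n, ?_⟩
    have h2 : ((k * t : ℝ) : ℂ) * Complex.I = ((n * (2 * Real.pi) : ℝ) : ℂ) * Complex.I := by
      push_cast
      linear_combination hn
    have h3 := Complex.ofReal_injective (mul_right_cancel₀ Complex.I_ne_zero h2)
    simp [h3]
  have ha' : a ∈ AddSubgroup.comap (zmultiplesHom ℝ t) (AddSubgroup.zmultiples (2 * Real.pi)) := by
    refine hle ?_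
    rw [ha]
    exact AddSubgroup.subset_closure rfl
  obtain ⟨n, hn⟩ := AddSubgroup.mem_zmultiples_iff.1 ha'
  simp only [zmultiplesHom_apply, zsmul_eq_mul] at hn
  have hda : (0 : ℝ) < a.natAbs := by exact_mod_cast hd
  have h1 : |(a : ℝ) * t| ≤ Real.pi := by
    rw [abs_mul, ← Int.cast_abs, ← Nat.cast_natAbs, mul_comm]
    rwa [le_div_iff₀ hda] at hta
  rw [← hn, abs_mul, abs_of_pos Real.two_pi_pos] at h1
  have h2 : |(n : ℝ)| < 1 := by
    by_contra! h
    nlinarith [Real.pi_pos]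
  have h3 : n = 0 := by
    rw [← Int.cast_abs] at h2
    exact Int.abs_lt_one_iff.1 (by exact_mod_cast h2)
  rw [h3, Int.cast_zero, zero_mul] at hn
  rcases mul_eq_zero.1 hn.symm with h | h
  · have : a = 0 := by exact_mod_cast h
    simp [this] at hd
  · exact ht h

end Span

/-! ### Characteristic function of the offspring law. -/

section Offspring

variable {ν : Measure ℕ} {σ : ℝ}

lemma hasSum_integral_nat {E : Type*} [NormedAddCommGroup E] [NormedSpace ℝ E] [CompleteSpace E]
    {f : ℕ → E} (hf : Integrable f ν) : HasSum (fun k => ν.real {k} • f k) (∫ k, f k ∂ν) := by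
  rw [← Measure.sum_smul_dirac ν] at hf
  have h := hasSum_integral_measure hf
  rw [Measure.sum_smul_dirac ν] at h
  refine h.congr_fun fun k => ?_
  rw [integral_smul_measure, integral_dirac, measureReal_def]

/-- The characteristic function of the centred offspring distribution. -/
noncomputable def centredCharFun (ν : Measure ℕ) : ℝ → ℂ :=
  charFun (ν.map fun k : ℕ => (k : ℝ) - 1)

lemma centredCharFun_eq (t : ℝ) :
    centredCharFun ν t = ∫ k : ℕ, Complex.exp (t * ((k : ℝ) - 1 : ℝ) * Complex.I) ∂ν := by
  rw [centredCharFun, charFun_apply_real, integral_map (by fun_prop) (by fun_prop)]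

variable [IsProbabilityMeasure ν]

lemma hasSum_measureReal_singleton : HasSum (fun k => ν.real {k}) 1 := by
  simpa using hasSum_integral_nat (ν := ν) (integrable_const (1 : ℝ))

lemma hasSum_centredCharFun (t : ℝ) :
    HasSum (fun k => (ν.real {k} : ℂ) * Complex.exp (t * Complex.I) ^ k)
      (centredCharFun ν t * Complex.exp (t * Complex.I)) := by
  have hi : Integrable (fun k : ℕ => Complex.exp (t * ((k : ℝ) - 1 : ℝ) * Complex.I)) ν := by
    refine Integrable.of_bound (by fun_prop) 1 (ae_of_all _ fun k => ?_)
    rw [← Complex.ofReal_mul, Complex.norm_exp_ofReal_mul_I]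
  have h := (hasSum_integral_nat hi).mul_right (Complex.exp (t * Complex.I))
  rw [← centredCharFun_eq] at h
  refine h.congr_fun fun k => ?_
  rw [Complex.real_smul, mul_assoc, ← Complex.exp_add, ← Complex.exp_nat_mul]
  congr 2
  push_cast
  ring

/-- Standardise to (ξ - 1)/σ, apply the second-order expansion `taylor_charFun_two`, and rescale t
by σ. -/
lemma tendsto_centredCharFun (hmean : ∫ k : ℕ, (k : ℝ) ∂ν = 1)
    (hL2 : MemLp (fun k : ℕ => (k : ℝ)) 2 ν)
    (hσ : σ ^ 2 = Var[fun k : ℕ => (k : ℝ); ν]) (hσ_pos : 0 < σ ^ 2) :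
    Tendsto (fun t : ℝ => (centredCharFun ν t - 1) / (t : ℂ) ^ 2) (𝓝[≠] 0)
      (𝓝 (-((σ ^ 2 / 2 : ℝ) : ℂ))) := by
  have hσ0 : σ ≠ 0 := by
    rintro rfl
    simp at hσ_pos
  have hi : Integrable (fun k : ℕ => (k : ℝ)) ν := hL2.integrable (by norm_num)
  have h0 : ν[fun k : ℕ => σ⁻¹ * ((k : ℝ) - 1)] = 0 := by
    rw [integral_const_mul, integral_sub hi (integrable_const _), hmean]
    simp
  have h1 : ν[(fun k : ℕ => σ⁻¹ * ((k : ℝ) - 1)) ^ 2] = 1 := by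
    rw [variance_eq_integral (by fun_prop), hmean] at hσ
    simp only [Pi.pow_apply, mul_pow]
    rw [integral_const_mul, ← hσ]
    field_simp
  have h2 := taylor_charFun_two (X := fun k : ℕ => σ⁻¹ * ((k : ℝ) - 1)) (by fun_prop) h0 h1
  have h3 : Tendsto (fun t : ℝ => σ * t) (𝓝[≠] 0) (𝓝 0) := by
    have : Continuous fun t : ℝ => σ * t := by fun_prop
    simpa using (this.tendsto 0).mono_left nhdsWithin_le_nhds
  have h4 := (h2.comp_tendsto h3).trans_isBigO (k := fun t : ℝ => t ^ 2) (by
    simp only [Function.comp_def, mul_pow]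
    exact Asymptotics.isBigO_const_mul_self _ _ _)
  have h5 : (fun t : ℝ => centredCharFun ν t - (1 - (σ * t : ℂ) ^ 2 / 2)) =o[𝓝[≠] 0]
      fun t : ℝ => (t : ℂ) ^ 2 := by
    refine (Asymptotics.IsLittleO.of_norm_right (h4.norm_right.congr_right fun t => ?_)).congr_left
      fun t => ?_
    · simp
    · simp only [Function.comp_apply]
      rw [charFun_map_mul_comp (by fun_prop), inv_mul_cancel_left₀ hσ0, centredCharFun]
      push_cast
      rfl
  have h6 := h5.tendsto_div_nhds_zero.add_const (-((σ ^ 2 / 2 : ℝ) : ℂ))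
  rw [zero_add] at h6
  refine h6.congr' ?_
  filter_upwards [self_mem_nhdsWithin] with t ht
  have ht : (t : ℂ) ≠ 0 := by exact_mod_cast ht
  field_simp
  push_cast
  ring

/-- If p_0 = 0 then ξ ≥ 1 almost surely; mean 1 then makes ξ constant, contradicting the nonzero
variance. -/
lemma measureReal_zero_ne_zero (hmean : ∫ k : ℕ, (k : ℝ) ∂ν = 1)
    (hL2 : MemLp (fun k : ℕ => (k : ℝ)) 2 ν)
    (hvar : Var[fun k : ℕ => (k : ℝ); ν] ≠ 0) : ν.real {0} ≠ 0 := by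
  intro h0
  apply hvar
  have hi : Integrable (fun k : ℕ => (k : ℝ)) ν := hL2.integrable (by norm_num)
  have h1 := hasSum_integral_nat (hi.sub (integrable_const (1 : ℝ)))
  have h2 : ∫ k : ℕ, ((fun k : ℕ => (k : ℝ)) - fun _ : ℕ => (1 : ℝ)) k ∂ν = 0 := by
    rw [integral_sub' hi (integrable_const _), hmean]
    simp
  rw [h2] at h1
  have h3 := (hasSum_zero_iff_of_nonneg fun k => ?_).1 h1
  · have hi2 : Integrable (fun k : ℕ => ((k : ℝ) - 1) ^ 2) ν :=
      (hL2.sub (memLp_const (1 : ℝ))).integrable_sq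
    rw [variance_eq_integral (by fun_prop), hmean, ← (hasSum_integral_nat hi2).tsum_eq]
    refine (tsum_congr fun k => ?_).trans tsum_zero
    have := congrFun h3 k
    simp only [Pi.sub_apply, Pi.zero_apply, smul_eq_mul] at this ⊢
    rw [sq, ← mul_assoc, this, zero_mul]
  · rcases Nat.eq_zero_or_pos k with rfl | hk
    · simp [h0]
    · have : (1 : ℝ) ≤ k := by exact_mod_cast hk
      exact mul_nonneg measureReal_nonneg (sub_nonneg.2 this)

lemma exists_measureReal_ne_zero (hmean : ∫ k : ℕ, (k : ℝ) ∂ν = 1)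
    (hL2 : MemLp (fun k : ℕ => (k : ℝ)) 2 ν) : ∃ k, k ≠ 0 ∧ ν.real {k} ≠ 0 := by
  by_contra! h
  have h1 := hasSum_integral_nat (hL2.integrable (by norm_num))
  rw [hmean] at h1
  refine one_ne_zero (h1.unique (hasSum_zero.congr_fun fun k => ?_))
  rcases eq_or_ne k 0 with rfl | hk
  · simp
  · simp [h k hk]

lemma exists_hasQuadraticMax (hmean : ∫ k : ℕ, (k : ℝ) ∂ν = 1)
    (hL2 : MemLp (fun k : ℕ => (k : ℝ)) 2 ν)
    (hσ : σ ^ 2 = Var[fun k : ℕ => (k : ℝ); ν]) (hσ_pos : 0 < σ ^ 2) :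
    ∃ d : ℕ, 0 < d ∧ (∀ k, ν.real {k} ≠ 0 → d ∣ k) ∧
      HasQuadraticMax (centredCharFun ν) (σ ^ 2) (Real.pi / d) := by
  obtain ⟨d, hd, hdvd, hlt⟩ := exists_span (p := fun k => ν.real {k}) (fun k => measureReal_nonneg)
    hasSum_measureReal_singleton (measureReal_zero_ne_zero hmean hL2 (hσ ▸ hσ_pos.ne'))
    (exists_measureReal_ne_zero hmean hL2)
  have hm : IsProbabilityMeasure (ν.map fun k : ℕ => (k : ℝ) - 1) :=
    Measure.isProbabilityMeasure_map (by fun_prop)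
  refine ⟨d, hd, hdvd, ?_, ?_, hσ_pos, div_pos Real.pi_pos (by exact_mod_cast hd),
    tendsto_centredCharFun hmean hL2 hσ hσ_pos, fun t ht hta => ?_⟩
  · exact continuous_charFun
  · simp [centredCharFun]
  · have := hlt t ht hta _ (hasSum_centredCharFun t)
    rwa [norm_mul, Complex.norm_exp_ofReal_mul_I, mul_one] at this

-- The generating function at e^{it} is ψ(t) e^{it}, so the total frequency is r + (m + j) - (m + 1)
-- = r + j - 1.
open PowerSeries in
lemma coeff_eq_oscInt {d : ℕ} (hd : 0 < d) (hdvd : ∀ k, ν.real {k} ≠ 0 → d ∣ k) {r m : ℕ} (j : ℕ)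
    (hr : d ∣ r) (hm : d ∣ m + 1) :
    2 * Real.pi / d * ((coeff (m + 1) (X ^ r * mk (fun k => ν.real {k}) ^ (m + j)) : ℝ) : ℂ) =
      oscInt (centredCharFun ν) (Real.pi / d) j (r + j - 1) m := by
  set f := mk (fun k => ν.real {k}) with hf
  have hfs : AbsSummable f := by
    have := (hasSum_measureReal_singleton (ν := ν)).summable
    simpa [AbsSummable, hf, abs_of_nonneg measureReal_nonneg] using this
  have hsupp : SupportedOn d f := by
    intro k hk
    rw [hf, coeff_mk]
    by_contra h
    exact hk (hdvd k h)
  rw [← integral_evalAt ((absSummable_X_pow r).mul (hfs.pow _)) hd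
    ((supportedOn_X_pow hr).mul (hsupp.pow _)) hm, oscInt]
  congr 1
  ext t
  have hz := Complex.norm_exp_ofReal_mul_I t
  have he : evalAt f (Complex.exp (t * Complex.I)) =
      centredCharFun ν t * Complex.exp (t * Complex.I) := by
    rw [evalAt, ← (hasSum_centredCharFun t).tsum_eq]
    simp [hf]
  rw [evalAt_mul (absSummable_X_pow r) (hfs.pow _) hz, evalAt_X_pow, evalAt_pow hfs hz, he,
    mul_pow, ← Complex.exp_nat_mul, ← Complex.exp_nat_mul, ← mul_assoc (_ ^ m), ← pow_add]
  rw [mul_left_comm, mul_assoc, mul_assoc, ← Complex.exp_add, ← Complex.exp_add]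
  congr 2
  push_cast
  ring

end Offspring

/-! ### Assembling the covariance limit. -/

lemma HasQuadraticMax.tendsto_cov {ψ : ℝ → ℂ} {v a : ℝ} (h : HasQuadraticMax ψ v a)
    (r s p q e : ℝ) :
    Tendsto (fun m : ℕ => (e : ℂ) * (oscInt ψ a 1 r m / oscInt ψ a 2 1 m) -
      p * q * (oscInt ψ a 0 (r + s - 1) m / oscInt ψ a 2 1 m) +
      p * q * ((m + 2) * (oscInt ψ a 2 1 m * oscInt ψ a 0 (r + s - 1) m -
        oscInt ψ a 1 r m * oscInt ψ a 1 s m) / oscInt ψ a 2 1 m ^ 2)) atTop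
      (𝓝 ((e - p * q - (r - 1) * (s - 1) * (p * q) / v : ℝ) : ℂ)) := by
  set c : ℝ := ∫ x : ℝ, x ^ 0 * Real.exp (-(v / 2) * x ^ 2) with hc
  have hc0 : c ≠ 0 := (integral_gaussian_pos h.variance_pos).ne'
  have hcc : (c : ℂ) ≠ 0 := by exact_mod_cast hc0
  have hratio (j : ℕ) (b : ℝ) :
      Tendsto (fun m : ℕ => oscInt ψ a j b m / oscInt ψ a 2 1 m) atTop (𝓝 1) := by
    have h1 := (h.tendsto_oscInt j b).div (h.tendsto_oscInt 2 1) hcc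
    rw [div_self hcc] at h1
    refine h1.congr' ?_
    filter_upwards [eventually_gt_atTop 0] with m hm
    have hm' : (0 : ℝ) < m := by exact_mod_cast hm
    exact mul_div_mul_left _ _ (by exact_mod_cast (Real.sqrt_pos.2 hm').ne')
  have hm2 : Tendsto (fun m : ℕ => 1 + 2 * (m : ℂ)⁻¹) atTop (𝓝 1) := by
    have h0 := (tendsto_inv_atTop_nhds_zero_nat (𝕜 := ℂ)).const_mul 2 |>.const_add 1
    simpa using h0
  -- Writes (m+2) det / I² as (1 + 2/m) m² det / (√m I)², where I is the integral in the
  -- denominator.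
  have hdet := (hm2.mul (h.tendsto_det_oscInt r s)).div ((h.tendsto_oscInt 2 1).pow 2)
    (pow_ne_zero 2 hcc)
  have key := (((hratio 1 r).const_mul (e : ℂ)).sub
    ((hratio 0 (r + s - 1)).const_mul (p * q : ℂ))).add (hdet.const_mul (p * q : ℂ))
  refine (key.congr' ?_).trans (le_of_eq ?_)
  · filter_upwards [eventually_gt_atTop 0] with m hm
    have hm' : (m : ℂ) ≠ 0 := by exact_mod_cast hm.ne'
    congr 2
    have h2 : ((√(m : ℝ) : ℝ) : ℂ) ^ 2 = m := by
      rw [← Complex.ofReal_pow, Real.sq_sqrt (Nat.cast_nonneg m), Complex.ofReal_natCast]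
    simp only [Pi.div_apply]
    rw [mul_pow, h2, ← mul_div_mul_left _ (oscInt ψ a 2 1 m ^ 2) hm']
    congr 1
    field_simp
  · have hv : (v : ℂ) ≠ 0 := by exact_mod_cast h.variance_pos.ne'
    rw [← hc]
    congr 1
    push_cast
    field_simp
    ring

variable {Ω : Type*} [MeasurableSpace Ω] {P : Measure Ω} [IsProbabilityMeasure P]
  {ν : Measure ℕ} {ξ : List ℕ → Ω → ℕ}

-- The mixed moment carries a factor n - 1 = m + 1; writing it as n - 1 separates the determinant
-- from the term -p_r p_s.
open PowerSeries in
lemma covariance_numOutdegree_eq_coeff (hmeas : ∀ u, Measurable (ξ u))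
    (hlaw : ∀ u, P.map (ξ u) = ν) (hindep : iIndepFun ξ P) {m : ℕ}
    (hm : P (sizeEvent ξ (m + 2)) ≠ 0) (r s : ℕ) (f : PowerSeries ℝ)
    (hf : f = mk fun k => ν.real {k}) :
    coeff (m + 1) (f ^ (m + 2)) ≠ 0 ∧
    cov[fun ω => (numOutdegree r (gwTree ξ ω) : ℝ), fun ω => (numOutdegree s (gwTree ξ ω) : ℝ);
        condMeasure P ξ (m + 2)] / ((m + 2 : ℕ) : ℝ) =
      (if r = s then ν.real {r} else 0) *
        (coeff (m + 1) (X ^ r * f ^ (m + 1)) / coeff (m + 1) (f ^ (m + 2))) -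
      ν.real {r} * ν.real {s} *
        (coeff (m + 1) (X ^ (r + s) * f ^ m) / coeff (m + 1) (f ^ (m + 2))) +
      ν.real {r} * ν.real {s} * ((m + 2) *
        (coeff (m + 1) (f ^ (m + 2)) * coeff (m + 1) (X ^ (r + s) * f ^ m) -
        coeff (m + 1) (X ^ r * f ^ (m + 1)) * coeff (m + 1) (X ^ s * f ^ (m + 1))) /
        coeff (m + 1) (f ^ (m + 2)) ^ 2) := by
  subst hf
  obtain ⟨h1, h2, h3⟩ := sum_forestWords_moments (fun k => ν.real {k}) r s m
  obtain ⟨-, h4, -⟩ := sum_forestWords_moments (fun k => ν.real {k}) s r m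
  have hZ : ∑ w ∈ forestWords (m + 2) 1, (w.map fun k => ν.real {k}).prod ≠ 0 := by
    rw [← measureReal_sizeEvent hmeas hlaw hindep, measureReal_ne_zero_iff]
    exact hm
  rw [covariance_numOutdegree hmeas hlaw hindep hm, h2, h3, h4, ← h1]
  generalize ∑ w ∈ forestWords (m + 2) 1, (w.map fun k => ν.real {k}).prod = Z at *
  have hm2 : (m + 2 : ℝ) ≠ 0 := by positivity
  refine ⟨mul_ne_zero hm2 hZ, ?_⟩
  push_cast
  field_simp
  ring

lemma tendsto_covariance_numOutdegree [IsProbabilityMeasure ν]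
    (hL2 : MemLp (fun k : ℕ => (k : ℝ)) 2 ν)
    (hmean : ∫ k : ℕ, (k : ℝ) ∂ν = 1)
    {σ : ℝ} (hσ : σ ^ 2 = Var[fun k : ℕ => (k : ℝ); ν]) (hσ_pos : 0 < σ ^ 2)
    (hmeas : ∀ u, Measurable (ξ u)) (hlaw : ∀ u, P.map (ξ u) = ν) (hindep : iIndepFun ξ P)
    (r s : ℕ) :
    Tendsto
      (fun n : ℕ =>
        cov[fun ω => (numOutdegree r (gwTree ξ ω) : ℝ),
            fun ω => (numOutdegree s (gwTree ξ ω) : ℝ); condMeasure P ξ n] / (n : ℝ))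
      (atTop ⊓ 𝓟 {n : ℕ | P (sizeEvent ξ n) ≠ 0})
      (𝓝 ((if r = s then ν.real {r} else 0) - ν.real {r} * ν.real {s}
        - ((r : ℝ) - 1) * ((s : ℝ) - 1) * (ν.real {r} * ν.real {s}) / σ ^ 2)) := by
  have hev : ∀ᶠ n in atTop ⊓ 𝓟 {n : ℕ | P (sizeEvent ξ n) ≠ 0},
      P (sizeEvent ξ n) ≠ 0 ∧ ∃ m, n = m + 2 := by
    rw [eventually_inf_principal]
    filter_upwards [eventually_ge_atTop 2] with n hn h
    exact ⟨h, n - 2, by omega⟩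
  -- In this case the covariance and the limit both vanish. It is separated because d need not
  -- divide r and s, which Fourier inversion requires.
  by_cases hrs : ν.real {r} * ν.real {s} = 0
  · have hδ : (if r = s then ν.real {r} else 0) = 0 := by
      split_ifs with h
      · subst h
        exact mul_self_eq_zero.1 hrs
      · rfl
    rw [hδ, hrs]
    simp only [mul_zero, zero_div, sub_zero]
    refine tendsto_const_nhds.congr' ?_
    filter_upwards [hev] with n hn
    obtain ⟨hn, m, rfl⟩ := hn
    rw [(covariance_numOutdegree_eq_coeff hmeas hlaw hindep hn r s _ rfl).2, hδ, hrs]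
    simp
  obtain ⟨d, hd, hdvd, hψ⟩ := exists_hasQuadraticMax hmean hL2 hσ hσ_pos
  have hr : d ∣ r := hdvd r (left_ne_zero_of_mul hrs)
  have hs : d ∣ s := hdvd s (right_ne_zero_of_mul hrs)
  have key := ((hψ.tendsto_cov r s (ν.real {r}) (ν.real {s})
    (if r = s then ν.real {r} else 0)).comp (tendsto_sub_atTop_nat 2)).mono_left
    (inf_le_left (b := 𝓟 {n : ℕ | P (sizeEvent ξ n) ≠ 0}))
  have key2 := (Complex.continuous_re.tendsto _).comp key
  rw [Complex.ofReal_re] at key2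
  refine key2.congr' ?_
  filter_upwards [hev] with n hn
  obtain ⟨hn, m, rfl⟩ := hn
  obtain ⟨hD, h⟩ := covariance_numOutdegree_eq_coeff hmeas hlaw hindep hn r s _ rfl
  -- A tree of size m + 2 has m + 1 edges; otherwise the normalising coefficient would be zero.
  have hm : d ∣ m + 1 := by
    by_contra hcon
    refine hD (SupportedOn.pow (fun k hk => ?_) _ _ hcon)
    rw [PowerSeries.coeff_mk]
    by_contra hk'
    exact hk (hdvd k hk')
  have e0 := coeff_eq_oscInt hd hdvd 0 (hr.add hs) hm
  have e1 := coeff_eq_oscInt hd hdvd 1 hr hm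
  have e2 := coeff_eq_oscInt hd hdvd 1 hs hm
  have e3 := coeff_eq_oscInt hd hdvd 2 (dvd_zero d) hm
  have f0 : ((r + s : ℕ) : ℝ) + ((0 : ℕ) : ℝ) - 1 = r + s - 1 := by push_cast; ring
  have f1 (x : ℕ) : (x : ℝ) + ((1 : ℕ) : ℝ) - 1 = x := by push_cast; ring
  have f3 : ((0 : ℕ) : ℝ) + ((2 : ℕ) : ℝ) - 1 = 1 := by norm_num
  rw [f0, add_zero] at e0
  rw [f1] at e1 e2
  rw [f3, pow_zero, one_mul] at e3
  have hκ : (2 * Real.pi / d : ℂ) ≠ 0 := by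
    have h1 : (Real.pi : ℂ) ≠ 0 := by exact_mod_cast Real.pi_ne_zero
    have h2 : (d : ℂ) ≠ 0 := by exact_mod_cast hd.ne'
    exact div_ne_zero (mul_ne_zero two_ne_zero h1) h2
  rw [h]
  simp only [Function.comp_apply, Nat.add_sub_cancel]
  rw [← e0, ← e1, ← e2, ← e3]
  generalize (2 * Real.pi / d : ℂ) = κ at *
  rw [mul_div_mul_left _ _ hκ, mul_div_mul_left _ _ hκ]
  rw [← Complex.ofReal_re (_ + _)]
  congr 1
  generalize PowerSeries.coeff (m + 1)
    ((PowerSeries.mk fun k => ν.real {k}) ^ (m + 2)) = D at *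
  have hD' : (D : ℂ) ≠ 0 := by exact_mod_cast hD
  push_cast
  field_simp

end GaltonWatson

theorem mainTheorem9
    {Ω : Type*} [MeasurableSpace Ω] (P : Measure Ω) [IsProbabilityMeasure P]
    -- the offspring distribution `ν`, the law of `ξ`
    (ν : Measure ℕ) [IsProbabilityMeasure ν]
    (hL2 : MemLp (fun k : ℕ => (k : ℝ)) 2 ν)
    (hmean : ∫ k : ℕ, (k : ℝ) ∂ν = 1)
    (σ : ℝ) (hσ : σ ^ 2 = Var[fun k : ℕ => (k : ℝ); ν]) (hσ_pos : 0 < σ ^ 2)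
    -- i.i.d. copies of `ξ`, indexed by the potential nodes
    (ξ : List ℕ → Ω → ℕ) (hmeas : ∀ u, Measurable (ξ u))
    (hlaw : ∀ u, P.map (ξ u) = ν) (hindep : iIndepFun ξ P) :
    (∀ r s : ℕ,
      Tendsto
        (fun n : ℕ =>
          cov[fun ω => (GaltonWatson.numOutdegree r (GaltonWatson.gwTree ξ ω) : ℝ),
              fun ω => (GaltonWatson.numOutdegree s (GaltonWatson.gwTree ξ ω) : ℝ);
              GaltonWatson.condMeasure P ξ n] / (n : ℝ))
        (atTop ⊓ 𝓟 {n : ℕ | P (GaltonWatson.sizeEvent ξ n) ≠ 0})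
        (𝓝 ((if r = s then ν.real {r} else 0) - ν.real {r} * ν.real {s}
          - ((r : ℝ) - 1) * ((s : ℝ) - 1) * (ν.real {r} * ν.real {s}) / σ ^ 2))) ∧
    (∀ r : ℕ,
      Tendsto
        (fun n : ℕ =>
          Var[fun ω => (GaltonWatson.numOutdegree r (GaltonWatson.gwTree ξ ω) : ℝ);
              GaltonWatson.condMeasure P ξ n] / (n : ℝ))
        (atTop ⊓ 𝓟 {n : ℕ | P (GaltonWatson.sizeEvent ξ n) ≠ 0})
        (𝓝 (ν.real {r} * (1 - ν.real {r})
          - ((r : ℝ) - 1) ^ 2 * ν.real {r} ^ 2 / σ ^ 2))) := by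
  have hcov := GaltonWatson.tendsto_covariance_numOutdegree hL2 hmean hσ hσ_pos hmeas hlaw hindep
  refine ⟨hcov, fun r => ?_⟩
  have h := hcov r r
  simp only [← GaltonWatson.variance_numOutdegree hmeas, if_true] at h
  convert h using 2
  ring
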